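/- Let $\Sigma=\mathbb{C}/2\pi i\mathbb{Z}$ be the infinite flat cylinder with coordinate $z=x+iy$ and measure $d\mu_\Sigma=dx\,dy$. An $n$-lump is a map $W:\Sigma\to\mathbb{CP}^1=\mathbb{C}\cup\{\infty\}$ of the form $W(z)=\tilde W(e^z)$ with $\tilde W=B/A$ a rational map of degree $n$ (so $A,B$ are coprime complex polynomials with $\max(\deg A,\deg B)=n$). For $p,q\in\mathbb{CP}^1$ let $\mathcal{M}_n^{(p,q)}$ be the space of $n$-lumps $W$ with endpoints $\lim_{x\to-\infty}W(x+iy)=p$ and $\lim_{x\to+\infty}W(x+iy)=q$, regarded as a submanifold of $\mathbb{CP}^{2n+1}$ through the coefficients $[A:B]$. Its $L^2$ metric $\gamma$ is the Riemannian metric for which a $C^1$ path $t\mapsto W_t$ in $\mathcal{M}_n^{(p,q)}$ satisfies $$\gamma_{W_t}(\dot W_t,\dot W_t)=\int_\Sigma\frac{4\,|\dot W_t|^2}{(1+|W_t|^2)^2}\,d\mu_\Sigma .$$ Theorem. For every $n\ge 2$ and every $(p,q)\in\mathbb{CP}^1\times\mathbb{CP}^1$, the metric $\gamma$ on $\mathcal{M}_n^{(p,q)}$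 is incomplete. That is, $\mathcal{M}_n^{(p,q)}$ with the distance given by the infimum of the $\gamma$-lengths of $C^1$ paths is not a complete metric space, and it is geodesically incomplete: there is a geodesic (a curve of constant speed that locally minimises length) defined on a bounded open interval that does not extend to a geodesic defined on all of $\mathbb{R}$. -/

import Mathlib

open Set Filter Topology MeasureTheory
open scoped ENNReal OnePoint

noncomputable section

namespace CylinderLumps

/-- Homogeneous coordinates on `ℂP^{2n+1}`: the coefficients of a pair of polynomials `(A, B)` of
degree at most `n`, the `k`-th entry being the coefficient of `w ^ k`. -/
abbrev Coeffs (n : ℕ) : Type := (Fin (n + 1) → ℂ) × (Fin (n + 1) → ℂ)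

/-- The polynomial `∑ a_k w^k`. -/
def toPoly {n : ℕ} (a : Fin (n + 1) → ℂ) : Polynomial ℂ :=
  ∑ k : Fin (n + 1), Polynomial.monomial (k : ℕ) (a k)

/-- The denominator `A (e^z)`. -/
def den {n : ℕ} (c : Coeffs n) (z : ℂ) : ℂ := (toPoly c.1).eval (Complex.exp z)

/-- The numerator `B (e^z)`. -/
def num {n : ℕ} (c : Coeffs n) (z : ℂ) : ℂ := (toPoly c.2).eval (Complex.exp z)

/-- `B / A` is a rational map of degree exactly `n` (nonvanishing resultant of the pair `A`, `B`
regarded as polynomials of formal degree `n`): `A` and `B` have no common root, and their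
coefficients of `w ^ n` are not both zero. -/
def HasDegree {n : ℕ} (c : Coeffs n) : Prop :=
  IsCoprime (toPoly c.1) (toPoly c.2) ∧ (c.1 (Fin.last n) ≠ 0 ∨ c.2 (Fin.last n) ≠ 0)

open Classical in
/-- The map `W z = B (e^z) / A (e^z)` with values in the Riemann sphere `ℂ ∪ {∞}`. Maps on the
cylinder `Σ = ℂ / 2πiℤ` are written as `2πi`-periodic maps on its universal cover `ℂ`. -/
def lumpMap {n : ℕ} (c : Coeffs n) (z : ℂ) : OnePoint ℂ :=
  if den c z = 0 then ∞ else ((num c z / den c z : ℂ) : OnePoint ℂ)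

/-- `W` is an `n`-lump: the composition of `exp : Σ → ℂP¹` with a rational map of degree `n`. -/
def IsLump (n : ℕ) (W : ℂ → OnePoint ℂ) : Prop :=
  ∃ c : Coeffs n, HasDegree c ∧ lumpMap c = W

/-- `W` has left endpoint `p` and right endpoint `q`: `W (x + i y)` tends to `p` as `x → -∞` and
to `q` as `x → +∞`. -/
def HasEndpoints (W : ℂ → OnePoint ℂ) (p q : OnePoint ℂ) : Prop :=
  ∀ y : ℝ, Tendsto (fun x : ℝ => W (x + y * Complex.I)) atBot (𝓝 p) ∧
    Tendsto (fun x : ℝ => W (x + y * Complex.I)) atTop (𝓝 q)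

/-- The fibre `M_n^{(p,q)}` of the moduli space of `n`-lumps over the pair of endpoints `(p, q)`. -/
def Fibre (n : ℕ) (p q : OnePoint ℂ) : Type :=
  {W : ℂ → OnePoint ℂ // IsLump n W ∧ HasEndpoints W p q}

/-- The squared length, in the round metric `4 |dW|² / (1 + |W|²)²` of the unit sphere, of the
variation of `W z = B / A` in the direction `v = (Ȧ, Ḃ)`. It is written in homogeneous coordinates,
so that it makes sense at the poles of `W` too; see `density_eq`. -/
def density {n : ℕ} (c v : Coeffs n) (z : ℂ) : ℝ :=
  4 * ‖den c z * num v z - num c z * den v z‖ ^ 2 / (‖den c z‖ ^ 2 + ‖num c z‖ ^ 2) ^ 2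

/-- Away from the poles of `W = B / A`, the density is `4 |Ẇ|² / (1 + |W|²)²`, where
`Ẇ = (A Ḃ - B Ȧ) / A²`. -/
theorem density_eq {n : ℕ} (c v : Coeffs n) (z : ℂ) (h : den c z ≠ 0) :
    density c v z =
      4 * ‖(den c z * num v z - num c z * den v z) / den c z ^ 2‖ ^ 2 /
        (1 + ‖num c z / den c z‖ ^ 2) ^ 2 := by
  have h' : ‖den c z‖ ≠ 0 := norm_ne_zero_iff.mpr h
  have h1 : ‖den c z‖ ^ 2 + ‖num c z‖ ^ 2 ≠ 0 := by positivity
  unfold density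
  rw [norm_div, norm_div, norm_pow]
  field_simp

/-- The value `γ|_W (X, X)` of the `L²` metric at `W = B / A` on the tangent vector `X` represented
by `v = (Ȧ, Ḃ)`: the integral of `density` over `Σ`, that is, over a fundamental strip. -/
def l2NormSq {n : ℕ} (c v : Coeffs n) : ℝ≥0∞ :=
  ∫⁻ z in {z : ℂ | z.im ∈ Ioc (-Real.pi) Real.pi}, ENNReal.ofReal (density c v z)

/-- The `L²` length of a path of lumps given by coefficients `c t`, `0 ≤ t ≤ 1`. -/
def pathLength {n : ℕ} (c : ℝ → Coeffs n) : ℝ≥0∞ :=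
  ∫⁻ t in Icc (0 : ℝ) 1, (l2NormSq (c t) (derivWithin c (Icc 0 1) t)) ^ (1 / 2 : ℝ)

/-- `c` represents a `C¹` path, parametrised by `[0, 1]`, from `W₀` to `W₁` in `M_n^{(p,q)}`. A path
in this submanifold of `ℂP^{2n+1}` is `C¹` exactly if it lifts to a `C¹` path of homogeneous
coordinates; `pathLength` does not depend on the lift. -/
structure IsPath {n : ℕ} {p q : OnePoint ℂ} (W₀ W₁ : Fibre n p q) (c : ℝ → Coeffs n) : Prop where
  contDiffOn : ContDiffOn ℝ 1 c (Icc 0 1)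
  hasDegree : ∀ t ∈ Icc (0 : ℝ) 1, HasDegree (c t)
  hasEndpoints : ∀ t ∈ Icc (0 : ℝ) 1, HasEndpoints (lumpMap (c t)) p q
  source : lumpMap (c 0) = W₀.1
  target : lumpMap (c 1) = W₁.1

/-- The Riemannian distance of the `L²` metric on `M_n^{(p,q)}`. -/
def l2Dist {n : ℕ} {p q : OnePoint ℂ} (W₀ W₁ : Fibre n p q) : ℝ≥0∞ :=
  ⨅ (c : ℝ → Coeffs n) (_ : IsPath W₀ W₁ c), pathLength c

/-- Completeness for a distance function `d`: every Cauchy sequence converges. -/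
def CauchyComplete {X : Type*} (d : X → X → ℝ≥0∞) : Prop :=
  ∀ u : ℕ → X, (∀ ε > 0, ∃ N, ∀ j ≥ N, ∀ k ≥ N, d (u j) (u k) < ε) →
    ∃ x, Tendsto (fun k => d (u k) x) atTop (𝓝 0)

/-- `c` is a geodesic on `I` for the Riemannian distance `d`: it is parametrised with constant
speed and locally minimises length. -/
def IsGeodesicOn {X : Type*} (d : X → X → ℝ≥0∞) (c : ℝ → X) (I : Set ℝ) : Prop :=
  ∃ v : ℝ, 0 ≤ v ∧ ∀ t ∈ I, ∃ ε > 0, ∀ s ∈ I, ∀ s' ∈ I, |s - t| < ε → |s' - t| < ε →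
    d (c s) (c s') = ENNReal.ofReal (v * |s - s'|)

/-- Geodesic completeness: every geodesic on a bounded open interval extends to a geodesic on the
whole real line. -/
def GeodesicallyComplete {X : Type*} (d : X → X → ℝ≥0∞) : Prop :=
  ∀ (a b : ℝ) (c : ℝ → X), a < b → IsGeodesicOn d c (Ioo a b) →
    ∃ c' : ℝ → X, IsGeodesicOn d c' univ ∧ EqOn c' c (Ioo a b)

end CylinderLumps

end

noncomputable section

namespace CylinderLumps

section HopfRinow

variable {X : Type*} [EMetricSpace X]

/-- Any two points at distance less than `L` are joined by a `1`-Lipschitz map of `[0, L]`. -/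
def IsLengthSpace (X : Type*) [EMetricSpace X] : Prop :=
  ∀ (x y : X) (L : ℝ), edist x y < ENNReal.ofReal L → ∃ γ : ℝ → X, γ 0 = x ∧ γ L = y ∧
    ∀ s ∈ Icc 0 L, ∀ s' ∈ Icc 0 L, edist (γ s) (γ s') ≤ ENNReal.ofReal |s - s'|

theorem exists_edist_eq_of_isGeodesicOn_extension {R : ℝ} (hR : 0 < R)
    (hg : GeodesicallyComplete (edist : X → X → ℝ≥0∞)) {Γ : ℝ → X}
    (hΓ : ∀ s ∈ Ioo 0 R, ∀ s' ∈ Ioo 0 R, edist (Γ s) (Γ s') = ENNReal.ofReal |s - s'|) :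
    ∃ z : X, ∃ ε > 0, ∀ s ∈ Ioo 0 R, R - ε < s → edist (Γ s) z = ENNReal.ofReal (R - s) := by
  obtain ⟨c', ⟨v, hv0, hv⟩, hc'⟩ := hg 0 R Γ hR
    ⟨1, zero_le_one, fun t _ => ⟨1, one_pos, fun s hs s' hs' _ _ => by rw [hΓ s hs s' hs', one_mul]⟩⟩
  have hv1 : v = 1 := by
    obtain ⟨ε, hε, h⟩ := hv (R / 2) (mem_univ _)
    set δ := min (ε / 2) (R / 4) with hδ
    have hδ0 : 0 < δ := by positivity
    have hδ1 : δ ≤ ε / 2 := min_le_left _ _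
    have hδ2 : δ ≤ R / 4 := min_le_right _ _
    have h1 := h (R / 2) (mem_univ _) (R / 2 + δ) (mem_univ _) (by simpa using hε)
      (by rw [abs_lt]; constructor <;> linarith)
    have m1 : R / 2 ∈ Ioo 0 R := ⟨by linarith, by linarith⟩
    have m2 : R / 2 + δ ∈ Ioo 0 R := ⟨by linarith, by linarith⟩
    rw [hc' m1, hc' m2, hΓ _ m1 _ m2] at h1
    have h2 : |R / 2 - (R / 2 + δ)| = δ := by
      rw [show R / 2 - (R / 2 + δ) = -δ by ring, abs_neg, abs_of_pos hδ0]
    rw [h2, ENNReal.ofReal_eq_ofReal_iff hδ0.le (by positivity)] at h1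
    have : (v - 1) * δ = 0 := by linarith
    rcases mul_eq_zero.1 this with h3 | h3 <;> linarith
  obtain ⟨ε, hε, h⟩ := hv R (mem_univ _)
  refine ⟨c' R, ε, hε, fun s hs hs' => ?_⟩
  have h1 := h s (mem_univ _) R (mem_univ _)
    (by rw [abs_lt]; constructor <;> linarith [hs.2]) (by simpa using hε)
  rw [hc' hs, hv1, one_mul, abs_sub_comm, abs_of_pos (by linarith [hs.2])] at h1
  exact h1

theorem isCompact_closedEBall_of_forall_lt (hlen : IsLengthSpace X)
    (hg : GeodesicallyComplete (edist : X → X → ℝ≥0∞)) (x₀ : X) {R : ℝ} (hR : 0 < R)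
    (hc : ∀ r < R, IsCompact (Metric.closedEBall x₀ (ENNReal.ofReal r))) :
    IsCompact (Metric.closedEBall x₀ (ENNReal.ofReal R)) := by
  rw [isCompact_iff_ultrafilter_le_nhds]
  intro F hF
  rw [le_principal_iff] at hF
  by_cases hr : ∃ r < R, Metric.closedEBall x₀ (ENNReal.ofReal r) ∈ F
  · obtain ⟨r, hrR, hr⟩ := hr
    obtain ⟨z, hz, hz'⟩ := isCompact_iff_ultrafilter_le_nhds.1 (hc r hrR) F (by simpa using hr)
    exact ⟨z, Metric.closedEBall_subset_closedEBall (ENNReal.ofReal_le_ofReal hrR.le) hz, hz'⟩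
  push Not at hr
  have hr' : ∀ r < R, ∀ᶠ y in (F : Filter X), ENNReal.ofReal r < edist y x₀ := by
    intro r h
    have := Ultrafilter.compl_mem_iff_notMem.2 (hr r h)
    filter_upwards [this] with y hy
    simpa using hy
  set d : X × ℕ → ℝ := fun p => (edist p.1 x₀).toReal with hd
  set L : X × ℕ → ℝ := fun p => d p + 1 / ((p.2 : ℝ) + 1) with hL
  have key : ∀ p : X × ℕ, ∃ γ : ℝ → X, p.1 ∈ Metric.closedEBall x₀ (ENNReal.ofReal R) →
      γ 0 = x₀ ∧ γ (L p) = p.1 ∧ ∀ s ∈ Icc 0 (L p), ∀ s' ∈ Icc 0 (L p),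
        edist (γ s) (γ s') ≤ ENNReal.ofReal |s - s'| := by
    intro p
    by_cases hp : p.1 ∈ Metric.closedEBall x₀ (ENNReal.ofReal R)
    · have hfin : edist p.1 x₀ ≠ ⊤ := ne_top_of_le_ne_top ENNReal.ofReal_ne_top hp
      obtain ⟨γ, h⟩ := hlen x₀ p.1 (L p) (by
        rw [edist_comm, ENNReal.lt_ofReal_iff_toReal_lt hfin]
        have : (0 : ℝ) < 1 / ((p.2 : ℝ) + 1) := by positivity
        simp only [hL, hd]; linarith)
      exact ⟨γ, fun _ => h⟩
    · exact ⟨fun _ => x₀, fun h => absurd h hp⟩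
  choose γ hγ using key
  set G : Ultrafilter (X × ℕ) := Ultrafilter.of ((F : Filter X) ×ˢ (atTop : Filter ℕ))
  have hG : (G : Filter (X × ℕ)) ≤ (F : Filter X) ×ˢ atTop := Ultrafilter.of_le _
  have hG1 : Tendsto Prod.fst (G : Filter (X × ℕ)) F := tendsto_fst.mono_left hG
  have hG2 : Tendsto Prod.snd (G : Filter (X × ℕ)) atTop := tendsto_snd.mono_left hG
  have hball : ∀ᶠ p in (G : Filter (X × ℕ)),
      p.1 ∈ Metric.closedEBall x₀ (ENNReal.ofReal R) := hG1.eventually hF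
  have hk : Tendsto (fun p : X × ℕ => 1 / ((p.2 : ℝ) + 1)) G (𝓝 0) :=
    tendsto_one_div_add_atTop_nhds_zero_nat.comp hG2
  have hdt : Tendsto d G (𝓝 R) := by
    rw [tendsto_order]
    constructor
    · intro r hrR
      filter_upwards [hball, hG1.eventually (hr' r hrR)] with p h1 h2
      have hfin : edist p.1 x₀ ≠ ⊤ := ne_top_of_le_ne_top ENNReal.ofReal_ne_top h1
      by_contra h
      refine absurd h2 (not_lt.2 ?_)
      rw [← ENNReal.ofReal_toReal hfin]
      exact ENNReal.ofReal_le_ofReal (not_lt.1 h)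
    · intro r hrR
      filter_upwards [hball] with p h1
      exact (ENNReal.toReal_le_of_le_ofReal hR.le h1).trans_lt hrR
  have hLt : Tendsto L G (𝓝 R) := by simpa only [add_zero] using hdt.add hk
  have hlim : ∀ s : ℝ, ∃ a : X, s ∈ Ioo 0 R → Tendsto (fun p => γ p s) G (𝓝 a) := by
    intro s
    by_cases hs : s ∈ Ioo 0 R
    · have : ∀ᶠ p in (G : Filter (X × ℕ)), γ p s ∈ Metric.closedEBall x₀ (ENNReal.ofReal s) := by
        filter_upwards [hball, hLt.eventually (lt_mem_nhds hs.2)] with p h1 h2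
        obtain ⟨e0, -, e1⟩ := hγ p h1
        have := e1 s ⟨hs.1.le, h2.le⟩ 0 ⟨le_rfl, (hs.1.trans h2).le⟩
        rwa [e0, sub_zero, abs_of_pos hs.1] at this
      obtain ⟨a, -, ha⟩ := isCompact_iff_ultrafilter_le_nhds.1 (hc s hs.2)
        (G.map (fun p => γ p s)) (le_principal_iff.2 this)
      exact ⟨a, fun _ => ha⟩
    · exact ⟨x₀, fun h => absurd h hs⟩
  choose Γ hΓ using hlim
  have hle : ∀ s ∈ Ioo 0 R, ∀ s' ∈ Ioo 0 R, s ≤ s' →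
      edist (Γ s) (Γ s') = ENNReal.ofReal (s' - s) := by
    intro s hs s' hs' hss
    have ht := (hΓ s hs).edist (hΓ s' hs')
    apply le_antisymm
    · refine le_of_tendsto ht ?_
      filter_upwards [hball, hLt.eventually (lt_mem_nhds hs'.2)] with p h1 h2
      have := (hγ p h1).2.2 s ⟨hs.1.le, hss.trans h2.le⟩ s' ⟨hs'.1.le, h2.le⟩
      rwa [abs_sub_comm, abs_of_nonneg (by linarith)] at this
    · have h3 : Tendsto (fun p : X × ℕ => ENNReal.ofReal ((s' - s) - 1 / ((p.2 : ℝ) + 1))) G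
          (𝓝 (ENNReal.ofReal (s' - s))) := by
        apply ENNReal.tendsto_ofReal
        simpa using (tendsto_const_nhds (x := s' - s)).sub hk
      refine le_of_tendsto_of_tendsto h3 ht ?_
      filter_upwards [hball, hLt.eventually (lt_mem_nhds hs'.2)] with p h1 h2
      have hfin : edist p.1 x₀ ≠ ⊤ := ne_top_of_le_ne_top ENNReal.ofReal_ne_top h1
      obtain ⟨e0, e1, e2⟩ := hγ p h1
      have a1 := e2 0 ⟨le_rfl, (hs'.1.trans h2).le⟩ s ⟨hs.1.le, hss.trans h2.le⟩
      have a2 := e2 s' ⟨hs'.1.le, h2.le⟩ (L p) ⟨(hs'.1.trans h2).le, le_rfl⟩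
      rw [e0, zero_sub, abs_neg, abs_of_pos hs.1] at a1
      rw [e1, abs_sub_comm, abs_of_pos (by linarith)] at a2
      by_cases hf : edist (γ p s) (γ p s') = ⊤
      · rw [hf]; exact le_top
      have a3 : edist p.1 x₀ ≤ ENNReal.ofReal (s + (edist (γ p s) (γ p s')).toReal + (L p - s')) := by
        rw [ENNReal.ofReal_add (by have := hs.1; positivity) (by linarith),
          ENNReal.ofReal_add hs.1.le (by positivity), ENNReal.ofReal_toReal hf, edist_comm p.1 x₀]
        exact (edist_triangle4 _ _ _ _).trans (add_le_add (add_le_add a1 le_rfl) a2)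
      have a4 : d p ≤ s + (edist (γ p s) (γ p s')).toReal + (L p - s') :=
        ENNReal.toReal_le_of_le_ofReal (by
          have := hs.1
          have : 0 ≤ (edist (γ p s) (γ p s')).toReal := by positivity
          linarith) a3
      rw [← ENNReal.ofReal_toReal hf]
      apply ENNReal.ofReal_le_ofReal
      simp only [hL] at a4
      linarith
  have hiso : ∀ s ∈ Ioo 0 R, ∀ s' ∈ Ioo 0 R, edist (Γ s) (Γ s') = ENNReal.ofReal |s - s'| := by
    intro s hs s' hs'
    rcases le_total s s' with h | h
    · rw [hle s hs s' hs' h, abs_sub_comm, abs_of_nonneg (by linarith)]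
    · rw [edist_comm, hle s' hs' s hs h, abs_of_nonneg (by linarith)]
  obtain ⟨z, ε, hε, hz⟩ := exists_edist_eq_of_isGeodesicOn_extension hR hg hiso
  have hzt : Tendsto Prod.fst (G : Filter (X × ℕ)) (𝓝 z) := by
    rw [EMetric.tendsto_nhds]
    intro η hη
    obtain ⟨s, hs1, hs2, hs3⟩ : ∃ s ∈ Ioo 0 R, R - ε < s ∧
        ENNReal.ofReal (R - s) + 0 + ENNReal.ofReal (R - s) < η := by
      have h1 : Tendsto (fun s : ℝ => ENNReal.ofReal (R - s) + 0 + ENNReal.ofReal (R - s))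
          (𝓝[<] R) (𝓝 0) := by
        have : Tendsto (fun s : ℝ => ENNReal.ofReal (R - s)) (𝓝[<] R) (𝓝 0) := by
          have : Tendsto (fun s : ℝ => ENNReal.ofReal (R - s)) (𝓝 R) (𝓝 (ENNReal.ofReal (R - R))) :=
            ENNReal.tendsto_ofReal (tendsto_const_nhds.sub tendsto_id)
          simpa using this.mono_left nhdsWithin_le_nhds
        simpa using this.add this
      have h2 := h1.eventually (gt_mem_nhds hη)
      have h3 : ∀ᶠ s in 𝓝[<] R, s ∈ Ioo (max 0 (R - ε)) R :=
        Ioo_mem_nhdsLT (max_lt hR (by linarith))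
      obtain ⟨s, h4, h5⟩ := (h2.and h3).exists
      exact ⟨s, ⟨(le_max_left _ _).trans_lt h5.1, h5.2⟩, (le_max_right _ _).trans_lt h5.1, h4⟩
    have h1 : Tendsto (fun p : X × ℕ => ENNReal.ofReal (L p - s) + edist (γ p s) (Γ s) +
        ENNReal.ofReal (R - s)) G (𝓝 (ENNReal.ofReal (R - s) + 0 + ENNReal.ofReal (R - s))) := by
      refine Tendsto.add (Tendsto.add (ENNReal.tendsto_ofReal (hLt.sub_const s)) ?_)
        tendsto_const_nhds
      exact tendsto_iff_edist_tendsto_0.1 (hΓ s hs1)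
    filter_upwards [hball, hLt.eventually (lt_mem_nhds hs1.2), h1.eventually (gt_mem_nhds hs3)]
      with p p1 p2 p3
    refine lt_of_le_of_lt ?_ p3
    obtain ⟨-, e1, e2⟩ := hγ p p1
    have a2 := e2 (L p) ⟨(hs1.1.trans p2).le, le_rfl⟩ s ⟨hs1.1.le, p2.le⟩
    rw [e1, abs_of_pos (by linarith)] at a2
    rw [← hz s hs1 hs2]
    exact (edist_triangle4 _ _ _ _).trans (add_le_add (add_le_add a2 le_rfl) le_rfl)
  have hFG : G.map Prod.fst = F := Ultrafilter.coe_le_coe.1 hG1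
  have hFz : (F : Filter X) ≤ 𝓝 z := by rw [← hFG]; exact hzt
  exact ⟨z, Metric.isClosed_closedEBall.mem_of_tendsto (f := id) (b := (F : Filter X)) hFz hF, hFz⟩

theorem exists_gt_isCompact_closedEBall [LocallyCompactSpace X] (hlen : IsLengthSpace X)
    (x₀ : X) {R : ℝ} (hR : 0 ≤ R) (hc : IsCompact (Metric.closedEBall x₀ (ENNReal.ofReal R))) :
    ∃ R' > R, IsCompact (Metric.closedEBall x₀ (ENNReal.ofReal R')) := by
  obtain ⟨K, hK, hsub⟩ := exists_compact_superset hc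
  obtain ⟨δ, hδ, hδK⟩ := hc.exists_cthickening_subset_open isOpen_interior hsub
  refine ⟨R + δ / 2, by linarith, hK.of_isClosed_subset Metric.isClosed_closedEBall ?_⟩
  intro y hy
  apply interior_subset
  apply hδK
  have hy' : edist x₀ y < ENNReal.ofReal (R + δ) := by
    rw [edist_comm]
    exact hy.trans_lt ((ENNReal.ofReal_lt_ofReal_iff (by linarith)).2 (by linarith))
  obtain ⟨γ, h0, h1, h2⟩ := hlen _ _ _ hy'
  have b1 := h2 R ⟨hR, by linarith⟩ 0 ⟨le_rfl, by linarith⟩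
  have b2 := h2 (R + δ) ⟨by linarith, le_rfl⟩ R ⟨hR, by linarith⟩
  rw [h0, sub_zero, abs_of_nonneg hR] at b1
  rw [h1, add_sub_cancel_left, abs_of_pos hδ] at b2
  exact Metric.mem_cthickening_of_edist_le y (γ R) δ _ b1 b2

/-- Hopf-Rinow: in a locally compact length space which is geodesically complete, balls of finite
radius are relatively compact. -/
theorem isCompact_closedEBall_of_geodesicallyComplete [LocallyCompactSpace X]
    (hlen : IsLengthSpace X) (hg : GeodesicallyComplete (edist : X → X → ℝ≥0∞)) (x₀ : X) (R : ℝ) :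
    IsCompact (Metric.closedEBall x₀ (ENNReal.ofReal R)) := by
  by_contra hR
  set S : Set ℝ := {r | IsCompact (Metric.closedEBall x₀ (ENNReal.ofReal r))} with hS
  have hmono : ∀ r r', r ≤ r' → r' ∈ S → r ∈ S := fun r r' h h' =>
    IsCompact.of_isClosed_subset h' Metric.isClosed_closedEBall
      (Metric.closedEBall_subset_closedEBall (ENNReal.ofReal_le_ofReal h))
  have h0 : (0 : ℝ) ∈ S := by simp [hS]
  have hbdd : BddAbove S := ⟨R, fun r hr => by
    by_contra h
    exact hR (hmono R r (not_le.1 h).le hr)⟩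
  obtain ⟨r₁, hr₁, hr₁S⟩ := exists_gt_isCompact_closedEBall hlen x₀ le_rfl h0
  have hpos : 0 < sSup S := hr₁.trans_le (le_csSup hbdd hr₁S)
  have hmem : sSup S ∈ S := isCompact_closedEBall_of_forall_lt hlen hg x₀ hpos (fun r hr => by
    obtain ⟨r', hr', hrr'⟩ := exists_lt_of_lt_csSup ⟨0, h0⟩ hr
    exact hmono r r' hrr'.le hr')
  obtain ⟨r₂, hr₂, hr₂S⟩ := exists_gt_isCompact_closedEBall hlen x₀ hpos.le hmem
  exact absurd (le_csSup hbdd hr₂S) (not_le.2 hr₂)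

theorem cauchyComplete_of_geodesicallyComplete [LocallyCompactSpace X]
    (hlen : IsLengthSpace X) (hg : GeodesicallyComplete (edist : X → X → ℝ≥0∞)) :
    CauchyComplete (edist : X → X → ℝ≥0∞) := by
  intro u hu
  have hcs : CauchySeq u := by
    rw [EMetric.cauchySeq_iff]
    exact hu
  obtain ⟨N, hN⟩ := hu 1 one_pos
  have hK := isCompact_closedEBall_of_geodesicallyComplete hlen hg (u N) 1
  obtain ⟨x, -, hx⟩ := cauchySeq_tendsto_of_isComplete hK.isComplete
    (u := fun k => u (k + N)) (fun k => by
      simpa using (hN (k + N) (by omega) N le_rfl).le) (hcs.comp_tendsto (tendsto_add_atTop_nat N))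
  exact ⟨x, tendsto_iff_edist_tendsto_0.1 ((tendsto_add_atTop_iff_nat N).1 hx)⟩

end HopfRinow

section ArcLength

variable {E : Type*} [NormedAddCommGroup E] [NormedSpace ℝ E] (N : E → E → ℝ≥0∞)

/-- The length of the restriction of `c` to `[a, b]`, for the speed function `N`. -/
def arcLength (c : ℝ → E) (a b : ℝ) : ℝ≥0∞ :=
  ∫⁻ t in Icc a b, N (c t) (derivWithin c (Icc a b) t)

theorem arcLength_eq_lintegral_Ioo (c : ℝ → E) (a b : ℝ) :
    arcLength N c a b = ∫⁻ t in Ioo a b, N (c t) (deriv c t) := by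
  rw [arcLength, ← restrict_Ioo_eq_restrict_Icc]
  refine setLIntegral_congr_fun measurableSet_Ioo (fun t ht => ?_)
  rw [derivWithin_of_mem_nhds (Icc_mem_nhds ht.1 ht.2)]

theorem arcLength_congr {c c' : ℝ → E} {a b : ℝ} (h : EqOn c c' (Ioo a b)) :
    arcLength N c a b = arcLength N c' a b := by
  simp only [arcLength_eq_lintegral_Ioo]
  refine setLIntegral_congr_fun measurableSet_Ioo (fun t ht => ?_)
  have : c =ᶠ[𝓝 t] c' := by
    filter_upwards [Ioo_mem_nhds ht.1 ht.2] with s hs using h hs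
  rw [h ht, this.deriv_eq]

theorem arcLength_add {c : ℝ → E} {x y z : ℝ} (h : x ≤ y) (h' : y ≤ z) :
    arcLength N c x y + arcLength N c y z = arcLength N c x z := by
  simp only [arcLength_eq_lintegral_Ioo, restrict_Ioo_eq_restrict_Icc]
  rw [← Icc_union_Ioc_eq_Icc h h', lintegral_union measurableSet_Ioc, restrict_Ioc_eq_restrict_Icc]
  exact disjoint_iff_forall_ne.mpr (fun a ha b hb => (ha.2.trans_lt hb.1).ne)

variable (hN : ∀ x (r : ℝ) v, N x (r • v) = ‖r‖ₑ * N x v)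

include hN

theorem arcLength_comp_of_monotoneOn {c : ℝ → E} {f : ℝ → ℝ} {a b : ℝ} (h : a < b)
    (hf : MonotoneOn f (Icc a b)) (hf' : DifferentiableOn ℝ f (Icc a b))
    (hc : DifferentiableOn ℝ c (Icc (f a) (f b))) :
    arcLength N (c ∘ f) a b = arcLength N c (f a) (f b) := by
  have him : f '' Icc a b = Icc (f a) (f b) := hf'.continuousOn.image_Icc_of_monotoneOn h.le hf
  have hd (t) (ht : t ∈ Icc a b) : HasDerivWithinAt f (derivWithin f (Icc a b) t) (Icc a b) t :=
    (hf' t ht).hasDerivWithinAt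
  simp only [arcLength, ← him]
  rw [lintegral_image_eq_lintegral_deriv_mul_of_monotoneOn measurableSet_Icc hd hf]
  refine setLIntegral_congr_fun measurableSet_Icc (fun t ht => ?_)
  have h1 : derivWithin (c ∘ f) (Icc a b) t =
      derivWithin f (Icc a b) t • derivWithin c (f '' Icc a b) (f t) := by
    refine derivWithin.scomp t ?_ (hf' t ht) (mapsTo_image _ _)
    rw [him]
    exact hc _ (him ▸ mem_image_of_mem f ht)
  have h0 : 0 ≤ derivWithin f (Icc a b) t := hf.derivWithin_nonneg
  simp only [h1, hN, Function.comp_apply, Real.enorm_of_nonneg h0]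

theorem arcLength_comp_of_antitoneOn {c : ℝ → E} {f : ℝ → ℝ} {a b : ℝ} (h : a < b)
    (hf : AntitoneOn f (Icc a b)) (hf' : DifferentiableOn ℝ f (Icc a b))
    (hc : DifferentiableOn ℝ c (Icc (f b) (f a))) :
    arcLength N (c ∘ f) a b = arcLength N c (f b) (f a) := by
  have him : f '' Icc a b = Icc (f b) (f a) := hf'.continuousOn.image_Icc_of_antitoneOn h.le hf
  have hd (t) (ht : t ∈ Icc a b) : HasDerivWithinAt f (derivWithin f (Icc a b) t) (Icc a b) t :=
    (hf' t ht).hasDerivWithinAt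
  simp only [arcLength, ← him]
  rw [lintegral_image_eq_lintegral_deriv_mul_of_antitoneOn measurableSet_Icc hd hf]
  refine setLIntegral_congr_fun measurableSet_Icc (fun t ht => ?_)
  have h1 : derivWithin (c ∘ f) (Icc a b) t =
      derivWithin f (Icc a b) t • derivWithin c (f '' Icc a b) (f t) := by
    refine derivWithin.scomp t ?_ (hf' t ht) (mapsTo_image _ _)
    rw [him]
    exact hc _ (him ▸ mem_image_of_mem f ht)
  have h0 : 0 ≤ -derivWithin f (Icc a b) t := by
    have := hf.derivWithin_nonpos (x := t); linarith
  simp only [h1, hN, Function.comp_apply]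
  rw [← Real.enorm_of_nonneg h0, enorm_neg]

end ArcLength

section Distance

variable {n : ℕ} {p q : OnePoint ℂ}

theorem den_smul (a : ℂ) (c : Coeffs n) (z : ℂ) : den (a • c) z = a * den c z := by
  simp [den, toPoly, Polynomial.eval_finsetSum, Finset.mul_sum, mul_assoc]

theorem num_smul (a : ℂ) (c : Coeffs n) (z : ℂ) : num (a • c) z = a * num c z := by
  simp [num, toPoly, Polynomial.eval_finsetSum, Finset.mul_sum, mul_assoc]

theorem toPoly_smul (a : ℂ) (c : Fin (n + 1) → ℂ) : toPoly (a • c) = Polynomial.C a * toPoly c := by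
  simp [toPoly, Finset.mul_sum, Polynomial.C_mul_monomial]

theorem lumpMap_smul {a : ℂ} (ha : a ≠ 0) (c : Coeffs n) : lumpMap (a • c) = lumpMap c := by
  funext z
  simp [lumpMap, den_smul, num_smul, ha, mul_div_mul_left]

theorem HasDegree.smul {c : Coeffs n} (hc : HasDegree c) {a : ℂ} (ha : a ≠ 0) :
    HasDegree (a • c) := by
  refine ⟨?_, by simpa [ha] using hc.2⟩
  have hu : IsUnit (Polynomial.C a) := Polynomial.isUnit_C.2 ha.isUnit
  simp only [Prod.smul_fst, Prod.smul_snd, toPoly_smul]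
  exact (isCoprime_mul_unit_left hu _ _).2 hc.1

theorem density_smul_smul {a : ℂ} (ha : a ≠ 0) (c v : Coeffs n) (z : ℂ) :
    density (a • c) (a • v) z = density c v z := by
  have ha' : ‖a‖ ≠ 0 := norm_ne_zero_iff.2 ha
  simp only [density, den_smul, num_smul]
  rw [show a * den c z * (a * num v z) - a * num c z * (a * den v z) =
    a ^ 2 * (den c z * num v z - num c z * den v z) by ring]
  simp only [norm_mul, norm_pow]
  rw [show (‖a‖ * ‖den c z‖) ^ 2 + (‖a‖ * ‖num c z‖) ^ 2 =
    ‖a‖ ^ 2 * (‖den c z‖ ^ 2 + ‖num c z‖ ^ 2) by ring]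
  rw [show 4 * (‖a‖ ^ 2 * ‖den c z * num v z - num c z * den v z‖) ^ 2 =
    (‖a‖ ^ 2) ^ 2 * (4 * ‖den c z * num v z - num c z * den v z‖ ^ 2) by ring, mul_pow,
    mul_div_mul_left _ _ (by positivity)]

theorem density_smul_right (r : ℝ) (c v : Coeffs n) (z : ℂ) :
    density c (r • v) z = r ^ 2 * density c v z := by
  have : r • v = (r : ℂ) • v := (Complex.coe_smul r v).symm
  simp only [density, this, den_smul, num_smul]
  rw [show den c z * (r * num v z) - num c z * (r * den v z) =
    r * (den c z * num v z - num c z * den v z) by ring, norm_mul, Complex.norm_real, mul_pow,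
    Real.norm_eq_abs, sq_abs]
  ring

/-- The norm of a tangent vector in the `L²` metric. -/
def l2Norm (c v : Coeffs n) : ℝ≥0∞ := l2NormSq c v ^ (1 / 2 : ℝ)

theorem l2Norm_smul (c : Coeffs n) (r : ℝ) (v : Coeffs n) : l2Norm c (r • v) = ‖r‖ₑ * l2Norm c v := by
  have h : l2NormSq c (r • v) = ‖r‖ₑ ^ 2 * l2NormSq c v := by
    rw [l2NormSq, l2NormSq, ← lintegral_const_mul' _ _ (by finiteness)]
    refine lintegral_congr fun z => ?_
    rw [density_smul_right, ENNReal.ofReal_mul (sq_nonneg r), ← sq_abs,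
      ENNReal.ofReal_pow (abs_nonneg r), ← Real.norm_eq_abs, ofReal_norm]
  rw [l2Norm, l2Norm, h, ENNReal.mul_rpow_of_nonneg _ _ (by norm_num), ← ENNReal.rpow_natCast,
    ← ENNReal.rpow_mul]
  norm_num

theorem l2Norm_smul_smul {a : ℂ} (ha : a ≠ 0) (c v : Coeffs n) :
    l2Norm (a • c) (a • v) = l2Norm c v := by
  simp only [l2Norm, l2NormSq, density_smul_smul ha]

/-- `c` represents an element of the fibre. -/
def InFibre (p q : OnePoint ℂ) (c : Coeffs n) : Prop :=
  HasDegree c ∧ HasEndpoints (lumpMap c) p q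

/-- The lump represented by `c`. -/
def InFibre.toFibre {c : Coeffs n} (h : InFibre p q c) : Fibre n p q :=
  ⟨lumpMap c, ⟨c, h.1, rfl⟩, h.2⟩

theorem InFibre.smul {c : Coeffs n} (hc : InFibre p q c) {a : ℂ} (ha : a ≠ 0) :
    InFibre p q (a • c) := ⟨hc.1.smul ha, by rw [lumpMap_smul ha]; exact hc.2⟩

theorem exists_inFibre (W : Fibre n p q) : ∃ c : Coeffs n, ∃ h : InFibre p q c, h.toFibre = W := by
  obtain ⟨W, ⟨c, hc, rfl⟩, h⟩ := W
  exact ⟨c, ⟨hc, h⟩, rfl⟩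

theorem l2Dist_le_arcLength {c : ℝ → Coeffs n} {a b : ℝ} (hab : a ≤ b)
    (hc : ContDiffOn ℝ 1 c (Icc a b)) (hF : ∀ t ∈ Icc a b, InFibre p q (c t)) :
    l2Dist (hF a ⟨le_rfl, hab⟩).toFibre (hF b ⟨hab, le_rfl⟩).toFibre ≤ arcLength l2Norm c a b := by
  set f : ℝ → ℝ := fun t => a + t * (b - a)
  have hf : ContDiff ℝ 1 f := by fun_prop
  have hm : Monotone f := fun s t hst => by
    have : 0 ≤ b - a := by linarith
    simp only [f]; gcongr
  have hmaps : MapsTo f (Icc 0 1) (Icc a b) := fun t ht => by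
    have h1 := hm ht.1
    have h2 := hm ht.2
    simp only [f, zero_mul, add_zero, one_mul] at h1 h2
    exact ⟨h1, by simp only [f]; linarith⟩
  have hp : IsPath (hF a ⟨le_rfl, hab⟩).toFibre (hF b ⟨hab, le_rfl⟩).toFibre (c ∘ f) := by
    refine ⟨hc.comp hf.contDiffOn hmaps, fun t ht => (hF _ (hmaps ht)).1,
      fun t ht => (hF _ (hmaps ht)).2, ?_, ?_⟩ <;> simp [f, InFibre.toFibre]
  refine (iInf₂_le _ hp).trans_eq ?_
  have := arcLength_comp_of_monotoneOn l2Norm l2Norm_smul (c := c) zero_lt_one (hm.monotoneOn _)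
    (hf.differentiable one_ne_zero).differentiableOn
    (by simpa [f] using hc.differentiableOn one_ne_zero)
  rw [show pathLength (c ∘ f) = arcLength l2Norm (c ∘ f) 0 1 from rfl, this]
  simp [f]

theorem l2Dist_le_of_path {W₀ W₁ : Fibre n p q} {c : ℝ → Coeffs n} {a b : ℝ} (hab : a ≤ b)
    (hc : ContDiffOn ℝ 1 c (Icc a b)) (hF : ∀ t ∈ Icc a b, InFibre p q (c t))
    (h₀ : lumpMap (c a) = W₀.1) (h₁ : lumpMap (c b) = W₁.1) :
    l2Dist W₀ W₁ ≤ arcLength l2Norm c a b := by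
  have e₀ : W₀ = (hF a ⟨le_rfl, hab⟩).toFibre := Subtype.ext h₀.symm
  have e₁ : W₁ = (hF b ⟨hab, le_rfl⟩).toFibre := Subtype.ext h₁.symm
  rw [e₀, e₁]
  exact l2Dist_le_arcLength hab hc hF

theorem exists_isPath_of_l2Dist_lt {W₀ W₁ : Fibre n p q} {r : ℝ≥0∞} (h : l2Dist W₀ W₁ < r) :
    ∃ c, IsPath W₀ W₁ c ∧ arcLength l2Norm c 0 1 < r := by
  simpa [l2Dist, iInf_lt_iff, arcLength, pathLength, l2Norm] using h

/-- A path of length less than `r`, parametrised by `[a, b]` and constant near the ends. -/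
theorem exists_locally_constant_of_l2Dist_lt {W₀ W₁ : Fibre n p q} {r : ℝ≥0∞}
    (h : l2Dist W₀ W₁ < r) {a b : ℝ} (hab : a < b) :
    ∃ c : ℝ → Coeffs n, ContDiff ℝ 1 c ∧ (∀ t, InFibre p q (c t)) ∧ arcLength l2Norm c a b < r ∧
      lumpMap (c a) = W₀.1 ∧ lumpMap (c b) = W₁.1 ∧
      (∀ᶠ t in 𝓝 a, c t = c a) ∧ ∀ᶠ t in 𝓝 b, c t = c b := by
  obtain ⟨γ, hγ, hr⟩ := exists_isPath_of_l2Dist_lt h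
  obtain ⟨a', haa', ha'b⟩ := exists_between hab
  obtain ⟨b', ha'b', hb'b⟩ := exists_between ha'b
  let η (t : ℝ) : ℝ := Real.smoothTransition ((b' - a')⁻¹ * (t - a'))
  have hη : ContDiff ℝ 1 η := by fun_prop
  have hm : Monotone η := Real.smoothTransition.monotone.comp fun t u htu => by
    have : 0 ≤ (b' - a')⁻¹ := by simpa using ha'b'.le
    gcongr
  have hmem (t : ℝ) : η t ∈ Icc (0 : ℝ) 1 :=
    ⟨Real.smoothTransition.nonneg _, Real.smoothTransition.le_one _⟩
  have hA (t) (ht : t < a') : η t = 0 := by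
    simp only [η, Real.smoothTransition.zero_iff_nonpos]
    apply mul_nonpos_of_nonneg_of_nonpos
    · simpa using ha'b'.le
    · linarith
  have hB (t) (ht : b' < t) : η t = 1 := by
    simp only [η, Real.smoothTransition.eq_one_iff_one_le, inv_mul_eq_div]
    rw [one_le_div₀] <;> linarith
  refine ⟨γ ∘ η, ?_, fun t => ⟨hγ.hasDegree _ (hmem t), hγ.hasEndpoints _ (hmem t)⟩, ?_, ?_, ?_,
    ?_, ?_⟩
  · rw [← contDiffOn_univ]
    exact hγ.contDiffOn.comp hη.contDiffOn (fun t _ => hmem t)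
  · rw [arcLength_comp_of_monotoneOn l2Norm l2Norm_smul hab (hm.monotoneOn _)
      (hη.differentiable one_ne_zero).differentiableOn, hA a haa', hB b hb'b]
    · exact hr
    · rw [hA a haa', hB b hb'b]
      exact hγ.contDiffOn.differentiableOn one_ne_zero
  · simp [hA a haa', hγ.source]
  · simp [hB b hb'b, hγ.target]
  · filter_upwards [Iio_mem_nhds haa'] with t ht
    simp [hA t ht, hA a haa']
  · filter_upwards [Ioi_mem_nhds hb'b] with t ht
    simp [hB t ht, hB b hb'b]

theorem arcLength_const_smul {a : ℂ} (ha : a ≠ 0) (c : ℝ → Coeffs n) (s t : ℝ)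
    (hc : Differentiable ℝ c) : arcLength l2Norm (fun x => a • c x) s t = arcLength l2Norm c s t := by
  simp only [arcLength_eq_lintegral_Ioo]
  refine lintegral_congr fun x => ?_
  have : deriv (fun x => a • c x) x = a • deriv c x := ((hc x).hasDerivAt.const_smul a).deriv
  rw [this, l2Norm_smul_smul ha]

theorem l2Dist_self (W : Fibre n p q) : l2Dist W W = 0 := by
  obtain ⟨c, hc, rfl⟩ := exists_inFibre W
  apply le_antisymm _ bot_le
  refine (l2Dist_le_of_path (c := fun _ => c) (le_refl (0 : ℝ)) contDiffOn_const (fun _ _ => hc)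
    rfl rfl).trans_eq ?_
  simp [arcLength]

theorem l2Dist_comm (W₀ W₁ : Fibre n p q) : l2Dist W₀ W₁ = l2Dist W₁ W₀ := by
  suffices H : ∀ W₀ W₁ : Fibre n p q, l2Dist W₁ W₀ ≤ l2Dist W₀ W₁ from le_antisymm (H _ _) (H _ _)
  intro W₀ W₁
  refine le_of_forall_gt fun r hr => ?_
  obtain ⟨c, hc, hF, hl, h0, h1, -, -⟩ := exists_locally_constant_of_l2Dist_lt hr zero_lt_one
  have hη : ContDiff ℝ 1 (fun t : ℝ => 1 - t) := by fun_prop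
  refine (l2Dist_le_of_path (c := c ∘ fun t => 1 - t) zero_le_one (hc.comp hη).contDiffOn
    (fun t _ => hF _) (by simpa using h1) (by simpa using h0)).trans_lt ?_
  rw [arcLength_comp_of_antitoneOn l2Norm l2Norm_smul zero_lt_one
    (fun s _ t _ hst => by simpa using sub_le_sub_left hst 1) (hη.differentiable one_ne_zero).differentiableOn
    (hc.differentiable one_ne_zero).differentiableOn]
  simpa using hl

end Distance

section Algebra

variable {n : ℕ} {p q : OnePoint ℂ}

theorem eval_toPoly (a : Fin (n + 1) → ℂ) (w : ℂ) :
    (toPoly a).eval w = ∑ k : Fin (n + 1), a k * w ^ (k : ℕ) := by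
  simp [toPoly, Polynomial.eval_finsetSum]

theorem coeff_toPoly (a : Fin (n + 1) → ℂ) (k : Fin (n + 1)) : (toPoly a).coeff k = a k := by
  simp [toPoly, Polynomial.coeff_monomial, Fin.val_inj]

theorem natDegree_toPoly_le (a : Fin (n + 1) → ℂ) : (toPoly a).natDegree ≤ n :=
  Polynomial.natDegree_sum_le_of_forall_le _ _ fun k _ =>
    (Polynomial.natDegree_monomial_le _).trans (Nat.lt_succ_iff.1 k.2)

/-- The coefficients, of degree at most `n`, of a polynomial. -/
def ofPoly (n : ℕ) (P : Polynomial ℂ) : Fin (n + 1) → ℂ := fun k => P.coeff k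

theorem toPoly_ofPoly {P : Polynomial ℂ} (h : P.natDegree ≤ n) : toPoly (ofPoly n P) = P := by
  ext k
  by_cases hk : k < n + 1
  · exact coeff_toPoly (ofPoly n P) ⟨k, hk⟩
  · rw [Polynomial.coeff_eq_zero_of_natDegree_lt, Polynomial.coeff_eq_zero_of_natDegree_lt]
    · omega
    · have := natDegree_toPoly_le (ofPoly n P); omega

theorem toPoly_injective : Function.Injective (toPoly (n := n)) := fun a b h => by
  ext k
  rw [← coeff_toPoly a, h, coeff_toPoly]

/-- The pair `(A w, B w)`. -/
def evalPair (c : Coeffs n) (w : ℂ) : ℂ × ℂ := ((toPoly c.1).eval w, (toPoly c.2).eval w)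

theorem evalPair_add (c d : Coeffs n) (w : ℂ) :
    evalPair (c + d) w = evalPair c w + evalPair d w := by
  simp [evalPair, eval_toPoly, add_mul, Finset.sum_add_distrib]

theorem evalPair_smul (a : ℂ) (c : Coeffs n) (w : ℂ) : evalPair (a • c) w = a • evalPair c w := by
  simp [evalPair, toPoly_smul]

theorem evalPair_sub (c d : Coeffs n) (w : ℂ) :
    evalPair (c - d) w = evalPair c w - evalPair d w := by
  simp [evalPair, eval_toPoly, sub_mul, Finset.sum_sub_distrib]

theorem continuous_evalPair : Continuous fun x : Coeffs n × ℂ => evalPair x.1 x.2 := by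
  simp only [evalPair, eval_toPoly]
  fun_prop

/-- The coefficients of `w ^ n A (1 / w)` and `w ^ n B (1 / w)`. -/
def revCoeffs (c : Coeffs n) : Coeffs n := (c.1 ∘ Fin.rev, c.2 ∘ Fin.rev)

theorem revCoeffs_revCoeffs (c : Coeffs n) : revCoeffs (revCoeffs c) = c := by
  simp [revCoeffs, Function.comp_assoc, Fin.rev_involutive.comp_self]

theorem norm_comp_rev (a : Fin (n + 1) → ℂ) : ‖a ∘ Fin.rev‖ = ‖a‖ := by
  refine le_antisymm ?_ ?_
  · exact (pi_norm_le_iff_of_nonneg (norm_nonneg _)).2 fun k => norm_le_pi_norm a _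
  · refine (pi_norm_le_iff_of_nonneg (norm_nonneg _)).2 fun k => ?_
    simpa using norm_le_pi_norm (a ∘ Fin.rev) k.rev

theorem norm_revCoeffs (c : Coeffs n) : ‖revCoeffs c‖ = ‖c‖ := by
  simp [revCoeffs, Prod.norm_def, norm_comp_rev]

theorem evalPair_eq_pow_smul (c : Coeffs n) {w : ℂ} (hw : w ≠ 0) :
    evalPair c w = w ^ n • evalPair (revCoeffs c) w⁻¹ := by
  have h : ∀ a : Fin (n + 1) → ℂ,
      (toPoly a).eval w = w ^ n * (toPoly (a ∘ Fin.rev)).eval w⁻¹ := by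
    intro a
    rw [eval_toPoly, eval_toPoly, Finset.mul_sum, ← Equiv.sum_comp Fin.revPerm]
    refine Finset.sum_congr rfl fun k _ => ?_
    have hk : (k : ℕ) ≤ n := Nat.lt_succ_iff.1 k.2
    have h1 : w ^ n = w ^ (n - (k : ℕ)) * w ^ (k : ℕ) := by rw [← pow_add, Nat.sub_add_cancel hk]
    simp only [Fin.revPerm_apply, Function.comp_apply, Fin.val_rev, h1, inv_pow]
    rw [show n + 1 - ((k : ℕ) + 1) = n - k by omega]
    field_simp
  ext <;> simp [evalPair, revCoeffs, h]

theorem evalPair_zero (c : Coeffs n) : evalPair c 0 = (c.1 0, c.2 0) := by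
  simp [evalPair, eval_toPoly, Fin.sum_univ_succ]

theorem evalPair_revCoeffs_zero (c : Coeffs n) :
    evalPair (revCoeffs c) 0 = (c.1 (Fin.last n), c.2 (Fin.last n)) := by
  simp [evalPair_zero, revCoeffs]

theorem norm_evalPair_le (c : Coeffs n) (w : ℂ) :
    ‖evalPair c w‖ ≤ (n + 1) * ‖c‖ * max 1 ‖w‖ ^ n := by
  have h : ∀ a : Fin (n + 1) → ℂ, ‖a‖ ≤ ‖c‖ →
      ‖(toPoly a).eval w‖ ≤ (n + 1) * ‖c‖ * max 1 ‖w‖ ^ n := by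
    intro a ha
    rw [eval_toPoly]
    refine (norm_sum_le _ _).trans ((Finset.sum_le_card_nsmul _ _ (‖c‖ * max 1 ‖w‖ ^ n)
      fun k _ => ?_).trans_eq (by simp [mul_assoc]))
    rw [norm_mul, norm_pow]
    have h1 : ‖w‖ ^ (k : ℕ) ≤ max 1 ‖w‖ ^ n :=
      (pow_le_pow_left₀ (norm_nonneg _) (le_max_right _ _) _).trans
        (pow_le_pow_right₀ (le_max_left _ _) (Nat.lt_succ_iff.1 k.2))
    exact mul_le_mul ((norm_le_pi_norm a k).trans ha) h1 (by positivity) (norm_nonneg _)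
  exact max_le (h _ (norm_fst_le c)) (h _ (norm_snd_le c))

theorem evalPair_ne_zero {c : Coeffs n} (h : HasDegree c) (w : ℂ) : evalPair c w ≠ 0 := by
  intro h0
  obtain ⟨u, v, huv⟩ := h.1
  have := congrArg (Polynomial.eval w) huv
  simp only [evalPair, Prod.mk_eq_zero] at h0
  simp [h0.1, h0.2] at this

theorem hasDegree_iff {c : Coeffs n} :
    HasDegree c ↔ (∀ w, evalPair c w ≠ 0) ∧ evalPair (revCoeffs c) 0 ≠ 0 := by
  refine ⟨fun h => ⟨evalPair_ne_zero h, ?_⟩, fun h => ⟨?_, ?_⟩⟩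
  · rw [evalPair_revCoeffs_zero]
    simpa [or_iff_not_imp_left] using h.2
  · rw [Polynomial.isCoprime_iff_aeval_ne_zero_of_isAlgClosed ℂ ℂ]
    intro w
    have := h.1 w
    simp only [evalPair, ne_eq, Prod.mk_eq_zero, not_and_or] at this
    simpa using this
  · have := h.2
    rw [evalPair_revCoeffs_zero, ne_eq, Prod.mk_eq_zero, not_and_or] at this
    exact this

theorem exists_le_norm_evalPair {c : Coeffs n} (h : ∀ w, evalPair c w ≠ 0) :
    ∃ m > 0, ∀ w, ‖w‖ ≤ 1 → m ≤ ‖evalPair c w‖ := by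
  have hc : Continuous fun w => ‖evalPair c w‖ :=
    (continuous_evalPair.comp (by fun_prop : Continuous fun w : ℂ => (c, w))).norm
  obtain ⟨w, -, hw⟩ := (isCompact_closedBall (0 : ℂ) 1).exists_isMinOn ⟨0, by simp⟩ hc.continuousOn
  exact ⟨_, norm_pos_iff.2 (h w), fun w' hw' => hw (by simpa using hw')⟩

/-- `c` is bounded below by `m` as a pair of homogeneous polynomials of degree `n`. -/
def BoundedBelow (c : Coeffs n) (m : ℝ) : Prop :=
  ∀ w : ℂ, m * max 1 ‖w‖ ^ n ≤ ‖evalPair c w‖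

theorem HasDegree.exists_boundedBelow {c : Coeffs n} (h : HasDegree c) :
    ∃ m > 0, BoundedBelow c m := by
  rw [hasDegree_iff] at h
  obtain ⟨m, hm, h1⟩ := exists_le_norm_evalPair h.1
  have hrev : ∀ w, evalPair (revCoeffs c) w ≠ 0 := by
    intro w
    by_cases hw : w = 0
    · rw [hw]; exact h.2
    · rw [evalPair_eq_pow_smul _ hw, revCoeffs_revCoeffs]
      exact smul_ne_zero (pow_ne_zero _ hw) (h.1 _)
  obtain ⟨m', hm', h2⟩ := exists_le_norm_evalPair hrev
  refine ⟨min m m', lt_min hm hm', fun w => ?_⟩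
  rcases le_total ‖w‖ 1 with hw | hw
  · rw [max_eq_left hw, one_pow, mul_one]
    exact (min_le_left _ _).trans (h1 w hw)
  · have hw0 : w ≠ 0 := by rw [← norm_pos_iff]; linarith
    rw [max_eq_right hw, evalPair_eq_pow_smul _ hw0, norm_smul, norm_pow, mul_comm]
    gcongr
    exact (min_le_right _ _).trans (h2 _ (by rw [norm_inv]; exact inv_le_one_of_one_le₀ hw))

theorem BoundedBelow.hasDegree {c : Coeffs n} {m : ℝ} (hm : 0 < m) (h : BoundedBelow c m) :
    HasDegree c := by
  refine hasDegree_iff.2 ⟨fun w => norm_pos_iff.1 (lt_of_lt_of_le (by positivity) (h w)), ?_⟩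
  have hc : Continuous fun w => ‖evalPair (revCoeffs c) w‖ :=
    (continuous_evalPair.comp (by fun_prop : Continuous fun w : ℂ => (revCoeffs c, w))).norm
  have ht : Tendsto (fun w => ‖evalPair (revCoeffs c) w‖) (𝓝[≠] 0)
      (𝓝 ‖evalPair (revCoeffs c) 0‖) := (hc.tendsto 0).mono_left nhdsWithin_le_nhds
  refine norm_pos_iff.1 (hm.trans_le (ge_of_tendsto ht ?_))
  filter_upwards [self_mem_nhdsWithin] with w hw
  have hw : w ≠ 0 := hw
  have hw' : 0 < ‖w‖ := norm_pos_iff.2 hw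
  rw [evalPair_eq_pow_smul _ hw, revCoeffs_revCoeffs, norm_smul, norm_pow]
  have h1 := h w⁻¹
  rw [norm_inv] at h1
  have h2 : 1 ≤ ‖w‖ ^ n * max 1 ‖w‖⁻¹ ^ n := by
    rw [← mul_pow]
    refine one_le_pow₀ ?_
    calc (1 : ℝ) = ‖w‖ * ‖w‖⁻¹ := by field_simp
      _ ≤ _ := by gcongr; exact le_max_right _ _
  calc m ≤ ‖w‖ ^ n * (m * max 1 ‖w‖⁻¹ ^ n) := by nlinarith
    _ ≤ _ := by gcongr

theorem BoundedBelow.of_norm_sub_le {c c' : Coeffs n} {m : ℝ} (h : BoundedBelow c m)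
    (h' : (n + 1) * ‖c' - c‖ ≤ m / 2) : BoundedBelow c' (m / 2) := by
  intro w
  have h1 : evalPair c' w = evalPair c w + evalPair (c' - c) w := by
    rw [evalPair_sub]; abel
  have h2 := norm_sub_norm_le (evalPair c w) (evalPair c w - evalPair c' w)
  rw [sub_sub_cancel, ← norm_neg (evalPair c w - _), neg_sub, ← evalPair_sub] at h2
  have h3 := norm_evalPair_le (c' - c) w
  have h4 := h w
  have h5 : (n + 1) * ‖c' - c‖ * max 1 ‖w‖ ^ n ≤ m / 2 * max 1 ‖w‖ ^ n := by gcongr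
  linarith

theorem isOpen_hasDegree : IsOpen {c : Coeffs n | HasDegree c} := by
  rw [Metric.isOpen_iff]
  intro c hc
  obtain ⟨m, hm, h⟩ := HasDegree.exists_boundedBelow hc
  refine ⟨m / (2 * (n + 1)), by positivity, fun c' hc' => ?_⟩
  refine (h.of_norm_sub_le (c' := c') ?_).hasDegree (half_pos hm)
  rw [Metric.mem_ball, dist_eq_norm] at hc'
  calc (n + 1) * ‖c' - c‖ ≤ (n + 1) * (m / (2 * (n + 1))) := by gcongr
    _ = m / 2 := by field_simp

theorem eq_smul_of_wedge_eq_zero {c c' : Coeffs n} (hc : HasDegree c)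
    (h : toPoly c.1 * toPoly c'.2 = toPoly c'.1 * toPoly c.2) : ∃ a : ℂ, c' = a • c := by
  obtain ⟨u, v, huv⟩ := hc.1
  set k := u * toPoly c'.1 + v * toPoly c'.2 with hk
  have h1 : toPoly c'.1 = k * toPoly c.1 := by
    rw [hk]
    linear_combination (-toPoly c'.1) * huv - v * h
  have h2 : toPoly c'.2 = k * toPoly c.2 := by
    rw [hk]
    linear_combination (-toPoly c'.2) * huv + u * h
  have hdeg : k.natDegree = 0 := by
    by_cases hk0 : k = 0
    · simp [hk0]
    have aux : ∀ a b : Fin (n + 1) → ℂ, a (Fin.last n) ≠ 0 → toPoly b = k * toPoly a →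
        k.natDegree = 0 := by
      intro a b ha hb
      have ha' : (toPoly a).coeff n ≠ 0 := by
        have := coeff_toPoly a (Fin.last n)
        rw [Fin.val_last] at this
        rwa [this]
      have hd : n ≤ (toPoly a).natDegree := Polynomial.le_natDegree_of_ne_zero ha'
      have hne : toPoly a ≠ 0 := fun h0 => by simp [h0] at ha'
      have := natDegree_toPoly_le b
      rw [hb, Polynomial.natDegree_mul hk0 hne] at this
      omega
    rcases hc.2 with h3 | h3
    · exact aux _ _ h3 h1
    · exact aux _ _ h3 h2
  obtain ⟨a, ha⟩ : ∃ a, k = Polynomial.C a := ⟨_, Polynomial.eq_C_of_natDegree_eq_zero hdeg⟩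
  refine ⟨a, Prod.ext (toPoly_injective ?_) (toPoly_injective ?_)⟩
  · rw [h1, ha, Prod.smul_fst, toPoly_smul]
  · rw [h2, ha, Prod.smul_snd, toPoly_smul]

/-- The determinant `u₁ v₂ - u₂ v₁`. -/
def wedge (u v : ℂ × ℂ) : ℂ := u.1 * v.2 - u.2 * v.1

theorem wedge_self (u : ℂ × ℂ) : wedge u u = 0 := by simp [wedge, mul_comm]

theorem toPoly_mul_eq_of_eventually {c c' : Coeffs n} {U : Set ℂ} (hU : IsOpen U)
    (hne : (0 : ℂ) ∈ U)
    (h : ∀ z ∈ U, wedge (evalPair c (Complex.exp z)) (evalPair c' (Complex.exp z)) = 0) :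
    toPoly c.1 * toPoly c'.2 = toPoly c'.1 * toPoly c.2 := by
  obtain ⟨ε, hε, hball⟩ := Metric.isOpen_iff.1 hU 0 hne
  refine Polynomial.eq_of_infinite_eval_eq _ _ (Set.Infinite.mono
    (s := (fun t : ℝ => Complex.exp t) '' Ioo 0 ε) ?_ ?_)
  · rintro _ ⟨t, ht, rfl⟩
    have := h t (hball (by simpa [abs_of_pos ht.1] using ht.2))
    simp only [wedge, evalPair] at this
    simp only [mem_ofPred_eq, Polynomial.eval_mul]
    linear_combination this
  · refine (Ioo_infinite hε).image fun s _ t _ hst => ?_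
    simpa [← Complex.ofReal_exp] using hst

theorem lumpMap_eq_of_smul {c c' : Coeffs n} (hc' : HasDegree c') {a : ℂ} (h : c' = a • c) :
    a ≠ 0 ∧ lumpMap c' = lumpMap c := by
  have ha : a ≠ 0 := by
    rintro rfl
    have := hc'.2
    simp [h] at this
  exact ⟨ha, by rw [h, lumpMap_smul ha]⟩

theorem exists_smul_of_lumpMap_eq {c c' : Coeffs n} (hc : HasDegree c) (hc' : HasDegree c')
    (h : lumpMap c = lumpMap c') : ∃ a : ℂ, a ≠ 0 ∧ c' = a • c := by
  have hw : ∀ z ∈ (univ : Set ℂ),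
      wedge (evalPair c (Complex.exp z)) (evalPair c' (Complex.exp z)) = 0 := by
    intro z _
    have hz := congrFun h z
    simp only [lumpMap] at hz
    change den c z * num c' z - num c z * den c' z = 0
    split_ifs at hz with h1 h2 h2
    · simp [h1, h2]
    · exact absurd hz (OnePoint.infty_ne_coe _)
    · exact absurd hz (OnePoint.coe_ne_infty _)
    · have := OnePoint.coe_injective hz
      rw [div_eq_div_iff h1 h2] at this
      linear_combination -this
  obtain ⟨a, ha⟩ := eq_smul_of_wedge_eq_zero hc (toPoly_mul_eq_of_eventually isOpen_univ
    (mem_univ _) hw)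
  exact ⟨a, (lumpMap_eq_of_smul hc' ha).1, ha⟩

end Algebra

section Endpoints

variable {n : ℕ} {p q : OnePoint ℂ}

/-- Homogeneous coordinates `(1, x)` of `x` and `(0, 1)` of `∞`. -/
def homCoord : OnePoint ℂ → ℂ × ℂ
  | some x => (1, x)
  | none => (0, 1)

theorem homCoord_infty : homCoord ∞ = (0, 1) := rfl

theorem homCoord_coe (x : ℂ) : homCoord x = (1, x) := rfl

theorem homCoord_ne_zero (p : OnePoint ℂ) : homCoord p ≠ 0 := by
  induction p using OnePoint.rec <;> simp [homCoord_infty, homCoord_coe]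

theorem wedge_homCoord_ne_zero (h : p ≠ q) : wedge (homCoord p) (homCoord q) ≠ 0 := by
  induction p using OnePoint.rec <;> induction q using OnePoint.rec <;>
    simp_all [homCoord_infty, homCoord_coe, wedge, sub_eq_zero, eq_comm]

theorem wedge_eq_zero_of_wedge_homCoord {u v : ℂ × ℂ} (hu : wedge u (homCoord p) = 0)
    (hv : wedge v (homCoord p) = 0) : wedge u v = 0 := by
  induction p using OnePoint.rec with
  | infty =>
    simp only [wedge, homCoord_infty] at *
    linear_combination v.2 * hu - u.2 * hv
  | coe x =>
    simp only [wedge, homCoord_coe] at *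
    linear_combination v.1 * hu - u.1 * hv

open Classical in
/-- The point of the sphere with the given homogeneous coordinates. -/
def toSphere (u : ℂ × ℂ) : OnePoint ℂ := if u.1 = 0 then ∞ else ((u.2 / u.1 : ℂ) : OnePoint ℂ)

theorem lumpMap_eq_toSphere (c : Coeffs n) (z : ℂ) :
    lumpMap c z = toSphere (evalPair c (Complex.exp z)) := rfl

theorem toSphere_smul {a : ℂ} (ha : a ≠ 0) (u : ℂ × ℂ) : toSphere (a • u) = toSphere u := by
  simp [toSphere, ha, mul_div_mul_left]

theorem toSphere_eq_iff {u : ℂ × ℂ} (hu : u ≠ 0) : toSphere u = p ↔ wedge u (homCoord p) = 0 := by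
  have hu' : u.1 ≠ 0 ∨ u.2 ≠ 0 := by
    by_contra h
    push Not at h
    exact hu (Prod.ext h.1 h.2)
  induction p using OnePoint.rec with
  | infty => simp [toSphere, wedge, homCoord_infty]
  | coe x =>
    by_cases h : u.1 = 0
    · simp [toSphere, wedge, homCoord_coe, h] at *
      simp [hu']
    · simp only [toSphere, h, wedge, homCoord_coe, if_false, OnePoint.coe_eq_coe, mul_one,
        div_eq_iff h, sub_eq_zero]
      rw [eq_comm, mul_comm]

theorem tendsto_toSphere {u : ℂ × ℂ} (hu : u ≠ 0) : Tendsto toSphere (𝓝 u) (𝓝 (toSphere u)) := by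
  have t1 : Tendsto (fun v : ℂ × ℂ => v.1) (𝓝 u) (𝓝 u.1) := continuous_fst.tendsto u
  have t2 : Tendsto (fun v : ℂ × ℂ => v.2) (𝓝 u) (𝓝 u.2) := continuous_snd.tendsto u
  by_cases h : u.1 = 0
  · have hu2 : u.2 ≠ 0 := fun h2 => hu (Prod.ext h h2)
    have hs : toSphere u = (∞ : OnePoint ℂ) := by simp [toSphere, h]
    rw [hs, tendsto_def]
    intro s hs
    obtain ⟨hs1, hs2⟩ : (∞ : OnePoint ℂ) ∈ s ∧ ∀ᶠ x : ℂ in cocompact ℂ, (x : OnePoint ℂ) ∈ s := by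
      refine ⟨mem_of_mem_nhds hs, ?_⟩
      rw [OnePoint.nhds_infty_eq] at hs
      have := (mem_sup.1 hs).1
      rw [mem_map, coclosedCompact_eq_cocompact] at this
      exact this
    have t3 : Tendsto (fun v : ℂ × ℂ => v.2 / v.1) (𝓝 u ⊓ 𝓟 {v | v.1 ≠ 0}) (cocompact ℂ) := by
      rw [← Metric.cobounded_eq_cocompact, ← tendsto_norm_atTop_iff_cobounded]
      simp only [norm_div]
      refine Tendsto.pos_mul_atTop (norm_pos_iff.2 hu2) ((t2.norm).mono_left inf_le_left) ?_
      refine tendsto_inv_nhdsGT_zero.comp (tendsto_nhdsWithin_iff.2 ⟨?_, ?_⟩)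
      · have := t1.norm
        rw [h, norm_zero] at this
        exact this.mono_left inf_le_left
      · filter_upwards [mem_inf_of_right (mem_principal_self _)] with v hv
        exact norm_pos_iff.2 hv
    have := t3.eventually hs2
    rw [eventually_inf_principal] at this
    filter_upwards [this] with v hv
    by_cases h1 : v.1 = 0
    · simpa [toSphere, h1] using hs1
    · simpa [toSphere, h1] using hv h1
  · have hs : toSphere u = ((u.2 / u.1 : ℂ) : OnePoint ℂ) := by simp [toSphere, h]
    rw [hs]
    have t3 : Tendsto (fun v : ℂ × ℂ => ((v.2 / v.1 : ℂ) : OnePoint ℂ)) (𝓝 u)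
        (𝓝 ((u.2 / u.1 : ℂ) : OnePoint ℂ)) :=
      (OnePoint.continuous_coe.tendsto _).comp (t2.div t1 h)
    refine t3.congr' ?_
    filter_upwards [t1.eventually_ne h] with v hv
    simp [toSphere, hv]

theorem tendsto_lumpMap {c : Coeffs n} (hc : HasDegree c) {ι : Type*} {l : Filter ι} {z : ι → ℂ}
    (hz : Tendsto (fun i => Complex.exp (z i)) l (𝓝 0)) :
    Tendsto (fun i => lumpMap c (z i)) l (𝓝 (toSphere (evalPair c 0))) := by
  simp only [lumpMap_eq_toSphere]
  refine (tendsto_toSphere (evalPair_ne_zero hc 0)).comp ?_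
  have : Continuous fun w => evalPair c w :=
    continuous_evalPair.comp (by fun_prop : Continuous fun w : ℂ => (c, w))
  exact (this.tendsto 0).comp hz

theorem lumpMap_revCoeffs (c : Coeffs n) (z : ℂ) : lumpMap c z = lumpMap (revCoeffs c) (-z) := by
  rw [lumpMap_eq_toSphere, lumpMap_eq_toSphere, evalPair_eq_pow_smul _ (Complex.exp_ne_zero z),
    toSphere_smul (pow_ne_zero _ (Complex.exp_ne_zero z)), Complex.exp_neg]

theorem HasDegree.revCoeffs {c : Coeffs n} (hc : HasDegree c) : HasDegree (revCoeffs c) := by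
  obtain ⟨h1, h2⟩ := hasDegree_iff.1 hc
  refine hasDegree_iff.2 ⟨fun w => ?_, by rw [revCoeffs_revCoeffs]; exact h1 0⟩
  by_cases hw : w = 0
  · rw [hw]; exact h2
  · rw [evalPair_eq_pow_smul _ hw, revCoeffs_revCoeffs]
    exact smul_ne_zero (pow_ne_zero _ hw) (h1 _)

/-- The linear conditions on the coefficients expressing that the endpoints are `p` and `q`. -/
def EndCond (p q : OnePoint ℂ) (c : Coeffs n) : Prop :=
  wedge (evalPair c 0) (homCoord p) = 0 ∧ wedge (evalPair (revCoeffs c) 0) (homCoord q) = 0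

theorem hasEndpoints_iff {c : Coeffs n} (hc : HasDegree c) :
    HasEndpoints (lumpMap c) p q ↔ EndCond p q c := by
  have hbot : ∀ y : ℝ, Tendsto (fun x : ℝ => lumpMap c (x + y * Complex.I)) atBot
      (𝓝 (toSphere (evalPair c 0))) := fun y => tendsto_lumpMap hc (by
    rw [tendsto_zero_iff_norm_tendsto_zero]
    simpa [Complex.norm_exp] using Real.tendsto_exp_atBot)
  have htop : ∀ y : ℝ, Tendsto (fun x : ℝ => lumpMap c (x + y * Complex.I)) atTop
      (𝓝 (toSphere (evalPair (revCoeffs c) 0))) := fun y => by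
    simp only [lumpMap_revCoeffs c]
    refine tendsto_lumpMap hc.revCoeffs ?_
    rw [tendsto_zero_iff_norm_tendsto_zero]
    simpa [Complex.norm_exp] using Real.tendsto_exp_neg_atTop_nhds_zero
  rw [EndCond, ← toSphere_eq_iff (evalPair_ne_zero hc 0),
    ← toSphere_eq_iff (evalPair_ne_zero hc.revCoeffs 0)]
  constructor
  · intro h
    exact ⟨tendsto_nhds_unique (hbot 0) (h 0).1, tendsto_nhds_unique (htop 0) (h 0).2⟩
  · rintro ⟨rfl, rfl⟩ y
    exact ⟨hbot y, htop y⟩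

theorem inFibre_iff {c : Coeffs n} : InFibre p q c ↔ HasDegree c ∧ EndCond p q c :=
  and_congr_right fun h => hasEndpoints_iff h

end Endpoints

section Metric

variable {n : ℕ} {p q : OnePoint ℂ}

theorem l2Dist_triangle (W₀ W₁ W₂ : Fibre n p q) :
    l2Dist W₀ W₂ ≤ l2Dist W₀ W₁ + l2Dist W₁ W₂ := by
  refine le_of_forall_gt fun r hr => ?_
  obtain ⟨u, hu, v, hv, huv⟩ := ENNReal.exists_add_lt_of_add_lt hr
  obtain ⟨c₁, hc₁, hF₁, hl₁, a₁, b₁, -, e₁⟩ := exists_locally_constant_of_l2Dist_lt hu zero_lt_one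
  obtain ⟨c₂, hc₂, hF₂, hl₂, a₂, b₂, e₂, -⟩ := exists_locally_constant_of_l2Dist_lt hv one_lt_two
  obtain ⟨a, ha, hac⟩ := exists_smul_of_lumpMap_eq (hF₂ 1).1 (hF₁ 1).1 (a₂.trans b₁.symm)
  set c₃ : ℝ → Coeffs n := fun t => a • c₂ t with hc₃
  set c := piecewise (Iic 1) c₁ c₃ with hcdef
  have hcd : ContDiff ℝ 1 c := by
    have hc₃' : ContDiff ℝ 1 c₃ := hc₂.const_smul a
    have hloc : ∀ᶠ t in 𝓝 (1 : ℝ), c t = c₁ 1 := by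
      filter_upwards [e₁, e₂] with t h1 h2
      by_cases ht : t ≤ 1
      · simp [c, ht, h1]
      · simp [c, ht, c₃, h2, hac]
    rw [contDiff_iff_contDiffAt]
    intro t
    rcases lt_trichotomy t 1 with ht | rfl | ht
    · refine hc₁.contDiffAt.congr_of_eventuallyEq ?_
      filter_upwards [Iio_mem_nhds ht] with s hs
      simp [c, (show s ≤ 1 from le_of_lt hs)]
    · exact (contDiffAt_const (c := c₁ 1)).congr_of_eventuallyEq hloc
    · refine hc₃'.contDiffAt.congr_of_eventuallyEq ?_
      filter_upwards [Ioi_mem_nhds ht] with s hs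
      simp [c, (show ¬ s ≤ 1 from not_le.2 hs)]
  have hF : ∀ t, InFibre p q (c t) := by
    intro t
    by_cases ht : t ≤ 1
    · simpa [c, ht] using hF₁ t
    · simpa [c, ht] using (hF₂ t).smul ha
  have h := l2Dist_le_of_path (W₀ := W₀) (W₁ := W₂) (zero_le_two (α := ℝ)) hcd.contDiffOn
    (fun t _ => hF t) (by simpa [c] using a₁) (by simpa [c, c₃, lumpMap_smul ha] using b₂)
  rw [← arcLength_add l2Norm zero_le_one one_le_two] at h
  refine (h.trans_lt ?_).trans huv
  refine ENNReal.add_lt_add ?_ ?_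
  · rwa [arcLength_congr l2Norm (c' := c₁) fun t ht => by simp [c, ht.2.le]]
  · rwa [arcLength_congr l2Norm (c' := c₃) fun t ht => by simp [c, ht.1],
      arcLength_const_smul ha _ _ _ (hc₂.differentiable one_ne_zero)]

end Metric

section Angle

/-- The square of the Hermitian norm on `ℂ²`. -/
def nsq (u : ℂ × ℂ) : ℝ := ‖u.1‖ ^ 2 + ‖u.2‖ ^ 2

theorem nsq_pos {u : ℂ × ℂ} (hu : u ≠ 0) : 0 < nsq u := by
  have : u.1 ≠ 0 ∨ u.2 ≠ 0 := by
    by_contra h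
    push Not at h
    exact hu (Prod.ext h.1 h.2)
  unfold nsq
  rcases this with h | h <;> have := norm_pos_iff.2 h <;> positivity

theorem nsq_nonneg (u : ℂ × ℂ) : 0 ≤ nsq u := by unfold nsq; positivity

theorem continuous_nsq : Continuous nsq := by unfold nsq; fun_prop

theorem norm_sq_le_nsq (u : ℂ × ℂ) : ‖u‖ ^ 2 ≤ nsq u := by
  unfold nsq
  rcases max_choice ‖u.1‖ ‖u.2‖ with h | h <;> rw [Prod.norm_def, h] <;> nlinarith [sq_nonneg ‖u.1‖, sq_nonneg ‖u.2‖]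

theorem continuous_wedge : Continuous fun x : (ℂ × ℂ) × (ℂ × ℂ) => wedge x.1 x.2 := by
  unfold wedge; fun_prop

theorem norm_mul_add_mul_sq_le (a b c d : ℂ) :
    ‖a * b + c * d‖ ^ 2 ≤ (‖a‖ ^ 2 + ‖c‖ ^ 2) * (‖b‖ ^ 2 + ‖d‖ ^ 2) := by
  have h := norm_add_le (a * b) (c * d)
  rw [norm_mul, norm_mul] at h
  have h0 : ‖a * b + c * d‖ ^ 2 ≤ (‖a‖ * ‖b‖ + ‖c‖ * ‖d‖) ^ 2 := by gcongr
  nlinarith [sq_nonneg (‖a‖ * ‖d‖ - ‖b‖ * ‖c‖)]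

theorem norm_wedge_sq_le (u v : ℂ × ℂ) : ‖wedge u v‖ ^ 2 ≤ nsq u * nsq v := by
  have := norm_mul_add_mul_sq_le u.1 v.2 (-u.2) v.1
  rw [norm_neg] at this
  simp only [wedge, nsq]
  rw [sub_eq_add_neg, ← neg_mul, add_comm (‖v.1‖ ^ 2)]
  exact this

/-- The squared sine of the angle between two complex lines: a quarter of the squared chordal
distance between two points of the sphere. -/
def sinSq (u v : ℂ × ℂ) : ℝ := ‖wedge u v‖ ^ 2 / (nsq u * nsq v)

theorem sinSq_nonneg (u v : ℂ × ℂ) : 0 ≤ sinSq u v :=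
  div_nonneg (sq_nonneg _) (mul_nonneg (nsq_nonneg _) (nsq_nonneg _))

theorem sinSq_le_one (u v : ℂ × ℂ) : sinSq u v ≤ 1 :=
  div_le_one_of_le₀ (norm_wedge_sq_le u v) (mul_nonneg (nsq_nonneg _) (nsq_nonneg _))

theorem sinSq_self (u : ℂ × ℂ) : sinSq u u = 0 := by simp [sinSq, wedge_self]

theorem wedge_eq_zero_of_sinSq {u v : ℂ × ℂ} (h : sinSq u v = 0) : wedge u v = 0 := by
  by_cases hu : u = 0
  · simp [hu, wedge]
  by_cases hv : v = 0
  · simp [hv, wedge]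
  have := nsq_pos hu
  have := nsq_pos hv
  rw [sinSq, div_eq_zero_iff] at h
  rcases h with h | h
  · simpa using h
  · exact absurd h (by positivity)

theorem sinSq_smul_left {a : ℂ} (ha : a ≠ 0) (u v : ℂ × ℂ) : sinSq (a • u) v = sinSq u v := by
  have ha' : ‖a‖ ≠ 0 := norm_ne_zero_iff.2 ha
  have h1 : wedge (a • u) v = a * wedge u v := by simp [wedge]; ring
  have h2 : nsq (a • u) = ‖a‖ ^ 2 * nsq u := by simp [nsq]; ring
  rw [sinSq, sinSq, h1, h2, norm_mul, mul_pow, mul_assoc, mul_div_mul_left _ _ (by positivity)]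

theorem sinSq_comm (u v : ℂ × ℂ) : sinSq u v = sinSq v u := by
  have : wedge u v = - wedge v u := by simp [wedge]; ring
  rw [sinSq, sinSq, this, norm_neg, mul_comm (nsq u)]

theorem sinSq_smul_right {a : ℂ} (ha : a ≠ 0) (u v : ℂ × ℂ) : sinSq u (a • v) = sinSq u v := by
  rw [sinSq_comm, sinSq_smul_left ha, sinSq_comm]

open ComplexConjugate in
theorem abs_deriv_sinSq_numerator_le (a u u' : ℂ × ℂ) :
    |2 * inner ℝ (wedge a u) (wedge a u') * nsq u -
      ‖wedge a u‖ ^ 2 * (2 * inner ℝ u.1 u'.1 + 2 * inner ℝ u.2 u'.2)| ≤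
      2 * (nsq a * nsq u) * ‖wedge u u'‖ := by
  have hsq : ∀ z : ℂ, ((‖z‖ ^ 2 : ℝ) : ℂ) = conj z * z := fun z => by
    rw [mul_comm, Complex.mul_conj, Complex.normSq_eq_norm_sq]
  have hi : ∀ x y : ℂ, (inner ℝ x y : ℝ) = (conj x * y).re := fun x y => by
    rw [Complex.inner, mul_comm]
  set β : ℂ := a.1 * conj u.1 + a.2 * conj u.2 with hβ
  have key : 2 * inner ℝ (wedge a u) (wedge a u') * nsq u -
      ‖wedge a u‖ ^ 2 * (2 * inner ℝ u.1 u'.1 + 2 * inner ℝ u.2 u'.2) =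
      (2 * (conj (wedge a u) * wedge u u' * β)).re := by
    have e1 : conj (wedge a u) * wedge a u' * ((nsq u : ℝ) : ℂ) -
        ((‖wedge a u‖ ^ 2 : ℝ) : ℂ) * (conj u.1 * u'.1 + conj u.2 * u'.2) =
        conj (wedge a u) * wedge u u' * β := by
      rw [nsq, Complex.ofReal_add, hsq, hsq, hsq, hβ]
      simp only [wedge]
      ring
    rw [← e1]
    simp only [hi, Complex.mul_re, Complex.sub_re, Complex.ofReal_re, Complex.ofReal_im,
      Complex.add_re, Complex.re_ofNat, Complex.im_ofNat]
    ring
  rw [key]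
  refine (Complex.abs_re_le_norm _).trans ?_
  rw [norm_mul, norm_mul, norm_mul, Complex.norm_conj]
  have h1 := norm_wedge_sq_le a u
  have h2 : ‖β‖ ^ 2 ≤ nsq a * nsq u := by
    have := norm_mul_add_mul_sq_le a.1 (conj u.1) a.2 (conj u.2)
    simpa [nsq] using this
  have h3 : ‖wedge a u‖ * ‖β‖ ≤ nsq a * nsq u := by
    nlinarith [sq_nonneg (‖wedge a u‖ - ‖β‖)]
  have h4 : ‖(2 : ℂ)‖ = 2 := by simp
  rw [h4]
  nlinarith [norm_nonneg (wedge u u')]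

theorem sinSq_le_lintegral {γ : ℝ → ℂ × ℂ} (hγ : ContDiffOn ℝ 1 γ (Icc 0 1))
    (h0 : ∀ t ∈ Icc (0 : ℝ) 1, γ t ≠ 0) :
    ENNReal.ofReal (sinSq (γ 0) (γ 1)) ≤ ∫⁻ t in Icc (0 : ℝ) 1,
      ENNReal.ofReal (2 * ‖wedge (γ t) (derivWithin γ (Icc 0 1) t)‖ / nsq (γ t)) := by
  set a := γ 0 with ha
  have ha0 : 0 < nsq a := nsq_pos (h0 0 ⟨le_rfl, zero_le_one⟩)
  have c1 : ContDiffOn ℝ 1 (fun t => (γ t).1) (Icc 0 1) := contDiff_fst.comp_contDiffOn hγ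
  have c2 : ContDiffOn ℝ 1 (fun t => (γ t).2) (Icc 0 1) := contDiff_snd.comp_contDiffOn hγ
  have hh : ContDiffOn ℝ 1 (fun t => sinSq a (γ t)) (Icc 0 1) := by
    refine ContDiffOn.div ?_ ?_ fun t ht => (mul_pos ha0 (nsq_pos (h0 t ht))).ne'
    · exact ((contDiffOn_const.mul c2).sub (contDiffOn_const.mul c1)).norm_sq ℝ
    · exact contDiffOn_const.mul ((c1.norm_sq ℝ).add (c2.norm_sq ℝ))
  have hle := enorm_sub_le_lintegral_derivWithin_Icc_of_contDiffOn_Icc hh zero_le_one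
  rw [← ha, sinSq_self, sub_zero, Real.enorm_of_nonneg (sinSq_nonneg _ _)] at hle
  refine hle.trans (setLIntegral_mono' measurableSet_Icc fun t ht => ?_)
  have hR : 0 < nsq (γ t) := nsq_pos (h0 t ht)
  have hu : UniqueDiffWithinAt ℝ (Icc (0 : ℝ) 1) t := uniqueDiffOn_Icc zero_lt_one t ht
  have d := ((hγ t ht).differentiableWithinAt one_ne_zero).hasDerivWithinAt
  set u' := derivWithin γ (Icc 0 1) t
  have d1 : HasDerivWithinAt (fun t => (γ t).1) u'.1 (Icc 0 1) t := d.fst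
  have d2 : HasDerivWithinAt (fun t => (γ t).2) u'.2 (Icc 0 1) t := d.snd
  have d3 : HasDerivWithinAt (fun t => wedge a (γ t)) (wedge a u') (Icc 0 1) t :=
    (d2.const_mul a.1).sub (d1.const_mul a.2)
  have d4 : HasDerivWithinAt (fun t => nsq (γ t))
      (2 * inner ℝ (γ t).1 u'.1 + 2 * inner ℝ (γ t).2 u'.2) (Icc 0 1) t :=
    d1.norm_sq.add d2.norm_sq
  have d5 : HasDerivWithinAt (fun t => sinSq a (γ t)) _ (Icc 0 1) t :=
    d3.norm_sq.div (d4.const_mul (nsq a)) (mul_pos ha0 hR).ne'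
  rw [d5.derivWithin hu, ← ofReal_norm, Real.norm_eq_abs]
  apply ENNReal.ofReal_le_ofReal
  rw [abs_div, abs_of_nonneg (sq_nonneg (nsq a * nsq (γ t))), div_le_div_iff₀ (by positivity) hR]
  have hk := abs_deriv_sinSq_numerator_le a (γ t) u'
  rw [show 2 * inner ℝ (wedge a (γ t)) (wedge a u') * (nsq a * nsq (γ t)) - ‖wedge a (γ t)‖ ^ 2 *
      (nsq a * (2 * inner ℝ (γ t).1 u'.1 + 2 * inner ℝ (γ t).2 u'.2)) = nsq a *
      (2 * inner ℝ (wedge a (γ t)) (wedge a u') * nsq (γ t) -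
      ‖wedge a (γ t)‖ ^ 2 * (2 * inner ℝ (γ t).1 u'.1 + 2 * inner ℝ (γ t).2 u'.2)) by ring,
    abs_mul, abs_of_pos ha0]
  have h6 := mul_le_mul_of_nonneg_left hk (mul_pos ha0 hR).le
  linarith

end Angle

section LowerBound

variable {n : ℕ} {p q : OnePoint ℂ}

theorem density_eq_wedge (c v : Coeffs n) (z : ℂ) : density c v z =
    (2 * ‖wedge (evalPair c (Complex.exp z)) (evalPair v (Complex.exp z))‖ /
      nsq (evalPair c (Complex.exp z))) ^ 2 := by
  rw [div_pow, mul_pow]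
  norm_num
  rfl

/-- An integrated distance between the lumps represented by `c` and `c'`. -/
def sepInt (c c' : Coeffs n) : ℝ≥0∞ :=
  ∫⁻ z in Metric.ball (0 : ℂ) 1,
    ENNReal.ofReal (sinSq (evalPair c (Complex.exp z)) (evalPair c' (Complex.exp z)))

theorem sepInt_smul_left {a : ℂ} (ha : a ≠ 0) (c c' : Coeffs n) :
    sepInt (a • c) c' = sepInt c c' := by
  simp only [sepInt, evalPair_smul, sinSq_smul_left ha]

theorem sepInt_smul_right {a : ℂ} (ha : a ≠ 0) (c c' : Coeffs n) :
    sepInt c (a • c') = sepInt c c' := by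
  simp only [sepInt, evalPair_smul, sinSq_smul_right ha]

/-- A constant comparing `sepInt` with the distance. -/
def sepConst : ℝ≥0∞ := volume (Metric.ball (0 : ℂ) 1) ^ (1 / 2 : ℝ)

theorem sepConst_ne_top : sepConst ≠ ⊤ :=
  ENNReal.rpow_ne_top_of_nonneg (by norm_num) measure_ball_lt_top.ne

theorem ball_subset_strip : Metric.ball (0 : ℂ) 1 ⊆ {z : ℂ | z.im ∈ Ioc (-Real.pi) Real.pi} := by
  intro z hz
  have h1 : |z.im| < 1 := (Complex.abs_im_le_norm z).trans_lt (by simpa using hz)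
  have h2 := abs_lt.1 h1
  have := Real.pi_gt_three
  exact ⟨by linarith, by linarith⟩

theorem continuous_evalPair_exp (c : Coeffs n) : Continuous fun z => evalPair c (Complex.exp z) :=
  continuous_evalPair.comp (by fun_prop : Continuous fun z : ℂ => (c, Complex.exp z))

theorem setLIntegral_ball_density_le (c v : Coeffs n) :
    ∫⁻ z in Metric.ball (0 : ℂ) 1, ENNReal.ofReal
      (2 * ‖wedge (evalPair c (Complex.exp z)) (evalPair v (Complex.exp z))‖ /
        nsq (evalPair c (Complex.exp z))) ≤ sepConst * l2Norm c v := by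
  set f : ℂ → ℝ := fun z => 2 * ‖wedge (evalPair c (Complex.exp z)) (evalPair v (Complex.exp z))‖ /
        nsq (evalPair c (Complex.exp z)) with hf
  have hm : Measurable f := by
    refine Measurable.div ?_ ?_
    · exact (continuous_const.mul (continuous_wedge.comp ((continuous_evalPair_exp c).prodMk
        (continuous_evalPair_exp v))).norm).measurable
    · exact (continuous_nsq.comp (continuous_evalPair_exp c)).measurable
  have hf0 : ∀ z, 0 ≤ f z := fun z => div_nonneg (by positivity) (nsq_nonneg _)
  have h := ENNReal.lintegral_mul_le_Lp_mul_Lq (volume.restrict (Metric.ball (0 : ℂ) 1))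
    Real.HolderConjugate.two_two (f := fun _ => 1) (g := fun z => ENNReal.ofReal (f z))
    aemeasurable_const hm.ennreal_ofReal.aemeasurable
  simp only [Pi.mul_apply, one_mul, ENNReal.one_rpow, lintegral_const, MeasurableSet.univ,
    Measure.restrict_apply, univ_inter] at h
  refine h.trans ?_
  rw [sepConst]
  gcongr
  rw [l2Norm, l2NormSq]
  refine ENNReal.rpow_le_rpow ?_ (by norm_num)
  refine (lintegral_mono fun z => ?_).trans (lintegral_mono_set ball_subset_strip)
  rw [density_eq_wedge, ENNReal.ofReal_rpow_of_nonneg (hf0 z) (by norm_num), Real.rpow_two]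

theorem sepInt_le_arcLength {c : ℝ → Coeffs n} (hc : ContDiffOn ℝ 1 c (Icc 0 1))
    (hd : ∀ t ∈ Icc (0 : ℝ) 1, HasDegree (c t)) :
    sepInt (c 0) (c 1) ≤ sepConst * arcLength l2Norm c 0 1 := by
  set c' : ℝ → Coeffs n := fun t => derivWithin c (Icc 0 1) t with hc'
  set f : ℂ → ℝ → ℝ := fun z t =>
    2 * ‖wedge (evalPair (c t) (Complex.exp z)) (evalPair (c' t) (Complex.exp z))‖ /
        nsq (evalPair (c t) (Complex.exp z)) with hf
  have hpt : ∀ z, ENNReal.ofReal (sinSq (evalPair (c 0) (Complex.exp z))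
      (evalPair (c 1) (Complex.exp z))) ≤ ∫⁻ t in Icc (0 : ℝ) 1, ENNReal.ofReal (f z t) := by
    intro z
    let Lz : Coeffs n →ₗ[ℂ] ℂ × ℂ :=
      { toFun := fun c => evalPair c (Complex.exp z)
        map_add' := fun c d => evalPair_add c d _
        map_smul' := fun a c => evalPair_smul a c _ }
    let Lr : Coeffs n →L[ℝ] ℂ × ℂ := (LinearMap.toContinuousLinearMap Lz).restrictScalars ℝ
    refine (sinSq_le_lintegral (γ := fun t => evalPair (c t) (Complex.exp z))
      (Lr.contDiff.comp_contDiffOn hc) fun t ht => evalPair_ne_zero (hd t ht) _).trans_eq ?_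
    refine setLIntegral_congr_fun measurableSet_Icc fun t ht => ?_
    have hdw : derivWithin (fun t => evalPair (c t) (Complex.exp z)) (Icc 0 1) t =
        evalPair (c' t) (Complex.exp z) :=
      (Lr.hasFDerivAt.comp_hasDerivWithinAt t ((hc t ht).differentiableWithinAt
        one_ne_zero).hasDerivWithinAt).derivWithin (uniqueDiffOn_Icc zero_lt_one t ht)
    simp only [hdw, hf]
  calc sepInt (c 0) (c 1) ≤ ∫⁻ z in Metric.ball (0 : ℂ) 1, ∫⁻ t in Icc (0 : ℝ) 1,
        ENNReal.ofReal (f z t) := lintegral_mono fun z => hpt z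
    _ = ∫⁻ t in Icc (0 : ℝ) 1, ∫⁻ z in Metric.ball (0 : ℂ) 1, ENNReal.ofReal (f z t) := by
        refine lintegral_lintegral_swap (AEMeasurable.ennreal_ofReal ?_)
        rw [Measure.prod_restrict]
        refine ContinuousOn.aemeasurable ?_ (Metric.isOpen_ball.measurableSet.prod measurableSet_Icc)
        have k1 : ContinuousOn (fun x : ℂ × ℝ => evalPair (c x.2) (Complex.exp x.1))
            (Metric.ball 0 1 ×ˢ Icc 0 1) := by
          refine continuous_evalPair.comp_continuousOn (ContinuousOn.prodMk ?_ ?_)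
          · exact hc.continuousOn.comp continuousOn_snd fun x hx => hx.2
          · exact (Complex.continuous_exp.comp continuous_fst).continuousOn
        have k2 : ContinuousOn (fun x : ℂ × ℝ => evalPair (c' x.2) (Complex.exp x.1))
            (Metric.ball 0 1 ×ˢ Icc 0 1) := by
          refine continuous_evalPair.comp_continuousOn (ContinuousOn.prodMk ?_ ?_)
          · exact (hc.continuousOn_derivWithin (uniqueDiffOn_Icc zero_lt_one) le_rfl).comp
              continuousOn_snd fun x hx => hx.2
          · exact (Complex.continuous_exp.comp continuous_fst).continuousOn
        refine ContinuousOn.div ?_ ?_ fun x hx => (nsq_pos (evalPair_ne_zero (hd _ hx.2) _)).ne'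
        · exact continuousOn_const.mul (continuous_wedge.comp_continuousOn (k1.prodMk k2)).norm
        · exact continuous_nsq.comp_continuousOn k1
    _ ≤ ∫⁻ t in Icc (0 : ℝ) 1, sepConst * l2Norm (c t) (c' t) :=
        lintegral_mono fun t => setLIntegral_ball_density_le _ _
    _ = _ := lintegral_const_mul' _ _ sepConst_ne_top

theorem sepInt_le_l2Dist {c c' : Coeffs n} (hc : InFibre p q c) (hc' : InFibre p q c') :
    sepInt c c' ≤ sepConst * l2Dist hc.toFibre hc'.toFibre := by
  by_contra hlt
  rw [not_le] at hlt
  have h0 : sepConst ≠ 0 := by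
    simp [sepConst, NNReal.pi_ne_zero]
  have hlt' : l2Dist hc.toFibre hc'.toFibre < sepInt c c' / sepConst := by
    rw [ENNReal.lt_div_iff_mul_lt (Or.inl h0) (Or.inl sepConst_ne_top), mul_comm]
    exact hlt
  obtain ⟨γ, hγ, hl⟩ := exists_isPath_of_l2Dist_lt hlt'
  have m0 : (0 : ℝ) ∈ Icc (0 : ℝ) 1 := ⟨le_rfl, zero_le_one⟩
  have m1 : (1 : ℝ) ∈ Icc (0 : ℝ) 1 := ⟨zero_le_one, le_rfl⟩
  obtain ⟨a, ha, e⟩ := exists_smul_of_lumpMap_eq (hγ.hasDegree 0 m0) hc.1 hγ.source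
  obtain ⟨b, hb, e'⟩ := exists_smul_of_lumpMap_eq (hγ.hasDegree 1 m1) hc'.1 hγ.target
  have := sepInt_le_arcLength hγ.contDiffOn hγ.hasDegree
  rw [← sepInt_smul_left ha, ← sepInt_smul_right hb, ← e, ← e', mul_comm] at this
  exact absurd hl (not_lt.2 (ENNReal.div_le_of_le_mul this))

theorem exists_smul_of_sepInt_eq_zero {c c' : Coeffs n} (hc : HasDegree c)
    (h : sepInt c c' = 0) : ∃ a : ℂ, c' = a • c := by
  have hcont : Continuous fun z =>
      wedge (evalPair c (Complex.exp z)) (evalPair c' (Complex.exp z)) :=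
    continuous_wedge.comp ((continuous_evalPair_exp c).prodMk (continuous_evalPair_exp c'))
  have hm : Measurable fun z => ENNReal.ofReal
      (sinSq (evalPair c (Complex.exp z)) (evalPair c' (Complex.exp z))) := by
    refine (Measurable.div (hcont.norm.pow 2).measurable ?_).ennreal_ofReal
    exact ((continuous_nsq.comp (continuous_evalPair_exp c)).mul
      (continuous_nsq.comp (continuous_evalPair_exp c'))).measurable
  rw [sepInt, lintegral_eq_zero_iff hm] at h
  have h1 : (fun z => wedge (evalPair c (Complex.exp z)) (evalPair c' (Complex.exp z)))
      =ᵐ[volume.restrict (Metric.ball 0 1)] fun _ => 0 := by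
    filter_upwards [h] with z hz
    exact wedge_eq_zero_of_sinSq
      (le_antisymm (ENNReal.ofReal_eq_zero.1 hz) (sinSq_nonneg _ _))
  have h2 := Measure.eqOn_open_of_ae_eq h1 Metric.isOpen_ball hcont.continuousOn
    continuousOn_const
  exact eq_smul_of_wedge_eq_zero hc (toPoly_mul_eq_of_eventually Metric.isOpen_ball
    (Metric.mem_ball_self one_pos) fun z hz => h2 hz)

theorem ae_evalPair_exp_ne_zero {c : Coeffs n} (hc : c ≠ 0) :
    ∀ᵐ z : ℂ, evalPair c (Complex.exp z) ≠ 0 := by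
  have hfin : {w : ℂ | evalPair c w = 0}.Finite := by
    by_contra hinf
    apply hc
    have h0 : ∀ a : Fin (n + 1) → ℂ, (∀ w, evalPair c w = 0 → (toPoly a).eval w = 0) → a = 0 := by
      intro a ha
      apply toPoly_injective
      refine Polynomial.eq_of_infinite_eval_eq _ _ (Set.Infinite.mono ?_ hinf)
      intro w hw
      have : (toPoly (0 : Fin (n + 1) → ℂ)).eval w = 0 := by simp [toPoly]
      exact (ha w hw).trans this.symm
    refine Prod.ext (h0 _ fun w hw => ?_) (h0 _ fun w hw => ?_)
    · exact congrArg Prod.fst hw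
    · exact congrArg Prod.snd hw
  have hcount : (Complex.exp ⁻¹' {w : ℂ | evalPair c w = 0}).Countable :=
    Complex.countable_preimage_exp.2 hfin.countable
  simpa using hcount.ae_notMem volume

theorem continuousAt_sepInt (c : Coeffs n) (hc : c ≠ 0) {c' : Coeffs n} (hc' : c' ≠ 0) :
    ContinuousAt (sepInt c) c' := by
  refine tendsto_lintegral_filter_of_dominated_convergence (fun _ => 1) ?_ ?_ ?_ ?_
  · refine Eventually.of_forall fun d => ?_
    refine (Measurable.div ?_ ?_).ennreal_ofReal
    · exact ((continuous_wedge.comp ((continuous_evalPair_exp c).prodMk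
        (continuous_evalPair_exp d))).norm.pow 2).measurable
    · exact ((continuous_nsq.comp (continuous_evalPair_exp c)).mul
        (continuous_nsq.comp (continuous_evalPair_exp d))).measurable
  · refine Eventually.of_forall fun d => Eventually.of_forall fun z => ?_
    simpa using sinSq_le_one _ _
  · simp
  · filter_upwards [ae_restrict_of_ae (ae_evalPair_exp_ne_zero hc),
      ae_restrict_of_ae (ae_evalPair_exp_ne_zero hc')] with z h1 h2
    apply ENNReal.tendsto_ofReal
    have k : Tendsto (fun d : Coeffs n => evalPair d (Complex.exp z)) (𝓝 c')
        (𝓝 (evalPair c' (Complex.exp z))) :=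
      (continuous_evalPair.comp
        (by fun_prop : Continuous fun d : Coeffs n => (d, Complex.exp z))).tendsto c'
    refine Tendsto.div ?_ (tendsto_const_nhds.mul ((continuous_nsq.tendsto _).comp k))
      (mul_pos (nsq_pos h1) (nsq_pos h2)).ne'
    exact (((continuous_wedge.tendsto (_, _)).comp (tendsto_const_nhds.prodMk_nhds k)).norm).pow 2

theorem l2Dist_eq_zero {W₀ W₁ : Fibre n p q} (h : l2Dist W₀ W₁ = 0) : W₀ = W₁ := by
  obtain ⟨c, hc, rfl⟩ := exists_inFibre W₀
  obtain ⟨c', hc', rfl⟩ := exists_inFibre W₁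
  have h1 := sepInt_le_l2Dist hc hc'
  rw [h, mul_zero, nonpos_iff_eq_zero] at h1
  obtain ⟨a, ha⟩ := exists_smul_of_sepInt_eq_zero hc.1 h1
  exact Subtype.ext (lumpMap_eq_of_smul hc'.1 ha).2.symm

/-- The metric space structure given by the Riemannian distance. -/
instance : EMetricSpace (Fibre n p q) where
  edist := l2Dist
  edist_self := l2Dist_self
  edist_comm := l2Dist_comm
  edist_triangle := l2Dist_triangle
  eq_of_edist_eq_zero := l2Dist_eq_zero

theorem edist_eq_l2Dist (W₀ W₁ : Fibre n p q) : edist W₀ W₁ = l2Dist W₀ W₁ := rfl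

end LowerBound

section UpperBound

variable {n : ℕ} {p q : OnePoint ℂ}

theorem revCoeffs_add (c d : Coeffs n) : revCoeffs (c + d) = revCoeffs c + revCoeffs d := rfl

theorem revCoeffs_smul (a : ℂ) (c : Coeffs n) : revCoeffs (a • c) = a • revCoeffs c := rfl

theorem wedge_add_left (u u' v : ℂ × ℂ) : wedge (u + u') v = wedge u v + wedge u' v := by
  simp [wedge]; ring

theorem wedge_smul_left (a : ℂ) (u v : ℂ × ℂ) : wedge (a • u) v = a * wedge u v := by
  simp [wedge]; ring

theorem wedge_smul_right (a : ℂ) (u v : ℂ × ℂ) : wedge u (a • v) = a * wedge u v := by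
  simp [wedge]; ring

theorem norm_wedge_le (u v : ℂ × ℂ) : ‖wedge u v‖ ≤ 2 * ‖u‖ * ‖v‖ := by
  have h := norm_sub_le (u.1 * v.2) (u.2 * v.1)
  rw [norm_mul, norm_mul] at h
  have h1 : ‖u.1‖ * ‖v.2‖ ≤ ‖u‖ * ‖v‖ := mul_le_mul (norm_fst_le u) (norm_snd_le v)
    (norm_nonneg _) (norm_nonneg _)
  have h2 : ‖u.2‖ * ‖v.1‖ ≤ ‖u‖ * ‖v‖ := mul_le_mul (norm_snd_le u) (norm_fst_le v)
    (norm_nonneg _) (norm_nonneg _)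
  simp only [wedge]
  linarith

theorem EndCond.add {c d : Coeffs n} (hc : EndCond p q c) (hd : EndCond p q d) :
    EndCond p q (c + d) := by
  simp [EndCond, revCoeffs_add, evalPair_add, wedge_add_left, hc.1, hc.2, hd.1, hd.2]

theorem EndCond.smul {c : Coeffs n} (hc : EndCond p q c) (a : ℂ) : EndCond p q (a • c) := by
  simp [EndCond, revCoeffs_smul, evalPair_smul, wedge_smul_left, hc.1, hc.2]

theorem EndCond.sub {c d : Coeffs n} (hc : EndCond p q c) (hd : EndCond p q d) :
    EndCond p q (c - d) := by
  have := hc.add (hd.smul (-1))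
  simpa [sub_eq_add_neg] using this

theorem norm_evalPair_sub_le (c : Coeffs n) {w : ℂ} (hw : ‖w‖ ≤ 1) :
    ‖evalPair c w - evalPair c 0‖ ≤ (n + 1) * ‖c‖ * ‖w‖ := by
  have h : ∀ a : Fin (n + 1) → ℂ, ‖a‖ ≤ ‖c‖ →
      ‖(toPoly a).eval w - (toPoly a).eval 0‖ ≤ (n + 1) * ‖c‖ * ‖w‖ := by
    intro a ha
    rw [eval_toPoly, eval_toPoly, ← Finset.sum_sub_distrib]
    refine (norm_sum_le _ _).trans ((Finset.sum_le_card_nsmul _ _ (‖c‖ * ‖w‖)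
      fun k _ => ?_).trans_eq (by simp [mul_assoc]))
    rw [← mul_sub, norm_mul]
    refine mul_le_mul ((norm_le_pi_norm a k).trans ha) ?_ (norm_nonneg _) (norm_nonneg _)
    by_cases hk : (k : ℕ) = 0
    · simp [hk]
    · rw [zero_pow hk, sub_zero, norm_pow]
      exact pow_le_of_le_one (norm_nonneg _) hw hk
  exact max_le (h _ (norm_fst_le c)) (h _ (norm_snd_le c))

theorem norm_wedge_evalPair_le_of_le_one {c v : Coeffs n} {r : OnePoint ℂ}
    (hc : wedge (evalPair c 0) (homCoord r) = 0) (hv : wedge (evalPair v 0) (homCoord r) = 0)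
    {w : ℂ} (hw : ‖w‖ ≤ 1) :
    ‖wedge (evalPair c w) (evalPair v w)‖ ≤ 4 * (n + 1) ^ 2 * ‖c‖ * ‖v‖ * ‖w‖ := by
  have h0 := wedge_eq_zero_of_wedge_homCoord hc hv
  have h1 : wedge (evalPair c w) (evalPair v w) =
      wedge (evalPair c w - evalPair c 0) (evalPair v w) +
        wedge (evalPair c 0) (evalPair v w - evalPair v 0) := by
    simp only [wedge, Prod.fst_sub, Prod.snd_sub] at h0 ⊢
    linear_combination h0
  have b1 := norm_evalPair_sub_le c hw
  have b2 := norm_evalPair_sub_le v hw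
  have b3 : ‖evalPair v w‖ ≤ (n + 1) * ‖v‖ := by
    simpa [max_eq_left hw] using norm_evalPair_le v w
  have b4 : ‖evalPair c 0‖ ≤ (n + 1) * ‖c‖ := by
    simpa using norm_evalPair_le c 0
  rw [h1]
  calc _ ≤ 2 * ‖evalPair c w - evalPair c 0‖ * ‖evalPair v w‖ +
        2 * ‖evalPair c 0‖ * ‖evalPair v w - evalPair v 0‖ :=
      (norm_add_le _ _).trans (add_le_add (norm_wedge_le _ _) (norm_wedge_le _ _))
    _ ≤ 2 * ((n + 1) * ‖c‖ * ‖w‖) * ((n + 1) * ‖v‖) +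
        2 * ((n + 1) * ‖c‖) * ((n + 1) * ‖v‖ * ‖w‖) := by gcongr
    _ = _ := by ring

theorem norm_wedge_evalPair_exp_le {c v : Coeffs n} (hc : EndCond p q c) (hv : EndCond p q v)
    (z : ℂ) : ‖wedge (evalPair c (Complex.exp z)) (evalPair v (Complex.exp z))‖ ≤
      4 * (n + 1) ^ 2 * ‖c‖ * ‖v‖ * (max 1 ‖Complex.exp z‖ ^ n) ^ 2 * Real.exp (-|z.re|) := by
  have hn : ‖Complex.exp z‖ = Real.exp z.re := Complex.norm_exp z
  have hw0 : Complex.exp z ≠ 0 := Complex.exp_ne_zero z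
  rcases le_total z.re 0 with h | h
  · have hw : ‖Complex.exp z‖ ≤ 1 := by rw [hn]; exact Real.exp_le_one_iff.2 h
    rw [max_eq_left hw, one_pow, one_pow, mul_one, abs_of_nonpos h, neg_neg, ← hn]
    exact norm_wedge_evalPair_le_of_le_one hc.1 hv.1 hw
  · have hw : 1 ≤ ‖Complex.exp z‖ := by rw [hn]; exact Real.one_le_exp h
    have hw' : ‖(Complex.exp z)⁻¹‖ ≤ 1 := by rw [norm_inv]; exact inv_le_one_of_one_le₀ hw
    rw [max_eq_right hw, abs_of_nonneg h, Real.exp_neg, ← hn, evalPair_eq_pow_smul c hw0,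
      evalPair_eq_pow_smul v hw0, wedge_smul_left, wedge_smul_right, norm_mul, norm_mul, norm_pow,
      ← norm_inv]
    have := norm_wedge_evalPair_le_of_le_one hc.2 hv.2 hw'
    rw [norm_revCoeffs, norm_revCoeffs] at this
    calc _ ≤ ‖Complex.exp z‖ ^ n * (‖Complex.exp z‖ ^ n *
          (4 * (n + 1) ^ 2 * ‖c‖ * ‖v‖ * ‖(Complex.exp z)⁻¹‖)) := by gcongr
      _ = _ := by ring

theorem setLIntegral_strip_mul {f g : ℝ → ℝ≥0∞} (hf : Measurable f) (hg : Measurable g) :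
    ∫⁻ z in {z : ℂ | z.im ∈ Ioc (-Real.pi) Real.pi}, f z.re * g z.im =
      (∫⁻ x, f x) * ∫⁻ y in Ioc (-Real.pi) Real.pi, g y := by
  have hset : {z : ℂ | z.im ∈ Ioc (-Real.pi) Real.pi} =
      Complex.measurableEquivRealProd ⁻¹' (univ ×ˢ Ioc (-Real.pi) Real.pi) := by
    ext z; simp [Complex.measurableEquivRealProd]
  have h := Complex.volume_preserving_equiv_real_prod.setLIntegral_comp_preimage_emb
    Complex.measurableEquivRealProd.measurableEmbedding (fun x : ℝ × ℝ => f x.1 * g x.2)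
    (univ ×ˢ Ioc (-Real.pi) Real.pi)
  rw [hset]
  refine Eq.trans ?_ (h.trans ?_)
  · rfl
  · rw [Measure.volume_eq_prod, ← Measure.prod_restrict, Measure.restrict_univ,
      lintegral_prod_mul hf.aemeasurable hg.aemeasurable]

theorem lintegral_exp_neg_mul_abs_lt_top {s : ℝ} (hs : 0 < s) :
    ∫⁻ x : ℝ, ENNReal.ofReal (Real.exp (-(s * |x|))) < ⊤ := by
  have h1 : IntegrableOn (fun x : ℝ => Real.exp (-(s * |x|))) (Iic 0) :=
    (integrableOn_exp_mul_Iic hs 0).congr_fun (fun x hx => by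
      simp only [abs_of_nonpos (mem_Iic.1 hx)]; ring_nf) measurableSet_Iic
  have h2 : IntegrableOn (fun x : ℝ => Real.exp (-(s * |x|))) (Ioi 0) :=
    (exp_neg_integrableOn_Ioi 0 hs).congr_fun (fun x hx => by
      simp only [abs_of_pos (mem_Ioi.1 hx)]; ring_nf) measurableSet_Ioi
  have h3 := h1.union h2
  rw [Iic_union_Ioi, integrableOn_univ] at h3
  exact h3.lintegral_lt_top

/-- The area of the cylinder for the weight `exp (-2|x|)`. -/
def weightedArea : ℝ≥0∞ :=
  ∫⁻ z in {z : ℂ | z.im ∈ Ioc (-Real.pi) Real.pi}, ENNReal.ofReal (Real.exp (-|z.re|) ^ 2)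

theorem weightedArea_lt_top : weightedArea < ⊤ := by
  have h := setLIntegral_strip_mul
    (f := fun x => ENNReal.ofReal (Real.exp (-|x|) ^ 2)) (g := fun _ => 1)
    (by fun_prop) measurable_const
  simp only [mul_one] at h
  rw [weightedArea, h]
  refine ENNReal.mul_lt_top ?_ (by simp)
  have := lintegral_exp_neg_mul_abs_lt_top two_pos
  simpa only [← Real.exp_nat_mul, Nat.cast_ofNat, mul_neg] using this

theorem l2Norm_le {c v : Coeffs n} {m : ℝ} (hm : 0 < m) (hb : BoundedBelow c m)
    (hc : EndCond p q c) (hv : EndCond p q v) :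
    l2Norm c v ≤ ENNReal.ofReal (8 * (n + 1) ^ 2 * ‖c‖ * ‖v‖ / m ^ 2) *
      weightedArea ^ (1 / 2 : ℝ) := by
  set K := 8 * (n + 1) ^ 2 * ‖c‖ * ‖v‖ / m ^ 2 with hK
  have hK0 : 0 ≤ K := by positivity
  have h : l2NormSq c v ≤ ENNReal.ofReal K ^ 2 * weightedArea := by
    rw [l2NormSq, weightedArea, ← lintegral_const_mul' _ _ (by finiteness)]
    refine lintegral_mono fun z => ?_
    rw [← ENNReal.ofReal_pow hK0, ← ENNReal.ofReal_mul (by positivity), density_eq_wedge]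
    apply ENNReal.ofReal_le_ofReal
    rw [← mul_pow]
    have hnum := norm_wedge_evalPair_exp_le hc hv z
    have hden := norm_sq_le_nsq (evalPair c (Complex.exp z))
    have hB : 0 < max 1 ‖Complex.exp z‖ ^ n := by positivity
    have hden' : m ^ 2 * (max 1 ‖Complex.exp z‖ ^ n) ^ 2 ≤ nsq (evalPair c (Complex.exp z)) := by
      rw [← mul_pow]
      exact (pow_le_pow_left₀ (by positivity) (hb _) 2).trans hden
    refine pow_le_pow_left₀ (div_nonneg (by positivity) (nsq_nonneg _)) ?_ 2
    rw [div_le_iff₀ (lt_of_lt_of_le (by positivity) hden')]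
    calc _ ≤ 2 * (4 * (n + 1) ^ 2 * ‖c‖ * ‖v‖ * (max 1 ‖Complex.exp z‖ ^ n) ^ 2 *
          Real.exp (-|z.re|)) := by gcongr
      _ = K * Real.exp (-|z.re|) * (m ^ 2 * (max 1 ‖Complex.exp z‖ ^ n) ^ 2) := by
          rw [hK]; field_simp; ring
      _ ≤ _ := by gcongr
  rw [l2Norm]
  refine (ENNReal.rpow_le_rpow h (by norm_num)).trans_eq ?_
  rw [ENNReal.mul_rpow_of_nonneg _ _ (by norm_num), ← ENNReal.rpow_natCast, ← ENNReal.rpow_mul]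
  norm_num

theorem edist_le_of_line {c v : Coeffs n} {a b : ℝ} (hab : a ≤ b)
    (hF : ∀ t ∈ Icc a b, InFibre p q (c + t • v)) {M : ℝ≥0∞}
    (hM : ∀ t ∈ Icc a b, l2Norm (c + t • v) v ≤ M) :
    edist (hF a ⟨le_rfl, hab⟩).toFibre (hF b ⟨hab, le_rfl⟩).toFibre ≤ M * ENNReal.ofReal (b - a) := by
  refine (l2Dist_le_arcLength (c := fun t : ℝ => c + t • v) hab (by fun_prop) hF).trans ?_
  rw [arcLength_eq_lintegral_Ioo]
  calc _ ≤ ∫⁻ t in Ioo a b, M := by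
        refine setLIntegral_mono' measurableSet_Ioo fun t ht => ?_
        have hd : HasDerivAt (fun t : ℝ => c + t • v) v t := by
          simpa using ((hasDerivAt_id t).smul_const v).const_add c
        rw [hd.deriv]
        exact hM t ⟨ht.1.le, ht.2.le⟩
    _ = _ := by simp

theorem edist_toFibre_le {c c' : Coeffs n} (hc : InFibre p q c) (hc' : InFibre p q c') {m : ℝ}
    (hm : 0 < m) (hb : BoundedBelow c m) (h : (n + 1) * ‖c' - c‖ ≤ m / 2) :
    edist hc.toFibre hc'.toFibre ≤
      ENNReal.ofReal (8 * (n + 1) ^ 2 * (‖c‖ + m) * ‖c' - c‖ / (m / 2) ^ 2) *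
        weightedArea ^ (1 / 2 : ℝ) := by
  have e1 := (inFibre_iff.1 hc).2
  have ev : EndCond p q (c' - c) := (inFibre_iff.1 hc').2.sub e1
  have hn : (0 : ℝ) ≤ n := n.cast_nonneg
  have hsmall : ‖c' - c‖ ≤ m := by nlinarith [norm_nonneg (c' - c)]
  have hnt : ∀ t ∈ Icc (0 : ℝ) 1, ‖t • (c' - c)‖ ≤ ‖c' - c‖ := fun t ht => by
    rw [norm_smul, Real.norm_of_nonneg ht.1]
    exact mul_le_of_le_one_left (norm_nonneg _) ht.2
  have ht : ∀ t ∈ Icc (0 : ℝ) 1, BoundedBelow (c + t • (c' - c)) (m / 2) := fun t ht =>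
    hb.of_norm_sub_le (by
      rw [add_sub_cancel_left]
      exact (mul_le_mul_of_nonneg_left (hnt t ht) (by positivity)).trans h)
  have hE : ∀ t : ℝ, EndCond p q (c + t • (c' - c)) := fun t => by
    rw [← Complex.coe_smul]
    exact e1.add (ev.smul _)
  have hF : ∀ t ∈ Icc (0 : ℝ) 1, InFibre p q (c + t • (c' - c)) := fun t h =>
    inFibre_iff.2 ⟨(ht t h).hasDegree (half_pos hm), hE t⟩
  have key := edist_le_of_line zero_le_one hF
    (M := ENNReal.ofReal (8 * (n + 1) ^ 2 * (‖c‖ + m) * ‖c' - c‖ / (m / 2) ^ 2) *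
        weightedArea ^ (1 / 2 : ℝ)) (fun t h => by
      refine (l2Norm_le (half_pos hm) (ht t h) (hE t) ev).trans ?_
      have : ‖c + t • (c' - c)‖ ≤ ‖c‖ + m :=
        (norm_add_le _ _).trans (by linarith [hnt t h])
      gcongr)
  simpa using key

theorem continuous_toFibre :
    Continuous fun c : {c : Coeffs n // InFibre p q c} => c.2.toFibre := by
  rw [continuous_iff_continuousAt]
  rintro ⟨c, hc⟩
  obtain ⟨m, hm, hb⟩ := hc.1.exists_boundedBelow
  rw [ContinuousAt, tendsto_iff_edist_tendsto_0]
  have hval : Tendsto (fun d : {c : Coeffs n // InFibre p q c} => ‖d.1 - c‖) (𝓝 ⟨c, hc⟩) (𝓝 0) := by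
    have : Continuous fun d : {c : Coeffs n // InFibre p q c} => ‖d.1 - c‖ := by fun_prop
    simpa using this.tendsto ⟨c, hc⟩
  have hlim : Tendsto (fun d : {c : Coeffs n // InFibre p q c} =>
      ENNReal.ofReal (8 * (n + 1) ^ 2 * (‖c‖ + m) * ‖d.1 - c‖ / (m / 2) ^ 2) *
        weightedArea ^ (1 / 2 : ℝ)) (𝓝 ⟨c, hc⟩) (𝓝 0) := by
    have h1 : Tendsto (fun d : {c : Coeffs n // InFibre p q c} =>
      8 * (n + 1) ^ 2 * (‖c‖ + m) * ‖d.1 - c‖ / (m / 2) ^ 2) (𝓝 ⟨c, hc⟩) (𝓝 0) := by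
      simpa using (hval.const_mul (8 * (n + 1) ^ 2 * (‖c‖ + m))).div_const ((m / 2) ^ 2)
    have h2 := ENNReal.Tendsto.mul_const (b := weightedArea ^ (1 / 2 : ℝ))
      (ENNReal.tendsto_ofReal h1)
      (Or.inr (ENNReal.rpow_ne_top_of_nonneg (by norm_num) weightedArea_lt_top.ne))
    simpa using h2
  refine tendsto_of_tendsto_of_tendsto_of_le_of_le' tendsto_const_nhds hlim
    (Eventually.of_forall fun _ => zero_le) ?_
  have h3 : Tendsto (fun d : {c : Coeffs n // InFibre p q c} => (n + 1) * ‖d.1 - c‖) (𝓝 ⟨c, hc⟩)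
      (𝓝 0) := by simpa using hval.const_mul ((n : ℝ) + 1)
  filter_upwards [h3.eventually (gt_mem_nhds (half_pos hm))] with d hd
  rw [edist_comm]
  exact edist_toFibre_le hc d.2 hm hb hd.le

theorem isLengthSpace_fibre : IsLengthSpace (Fibre n p q) := by
  intro W₀ W₁ L hL
  obtain ⟨c, hc, hl⟩ := exists_isPath_of_l2Dist_lt (r := ENNReal.ofReal L) hL
  have hF : ∀ t ∈ Icc (0 : ℝ) 1, InFibre p q (c t) := fun t ht =>
    ⟨hc.hasDegree t ht, hc.hasEndpoints t ht⟩
  set ℓ : ℝ → ℝ≥0∞ := fun t => arcLength l2Norm c 0 t with hℓ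
  have hfin : ℓ 1 ≠ ⊤ := (hl.trans ENNReal.ofReal_lt_top).ne
  have hsub : ∀ a ∈ Icc (0 : ℝ) 1, ∀ b ∈ Icc (0 : ℝ) 1, a ≤ b →
      ℓ a + arcLength l2Norm c a b = ℓ b := fun a ha b hb hab => arcLength_add l2Norm ha.1 hab
  have hmono : ∀ a ∈ Icc (0 : ℝ) 1, ∀ b ∈ Icc (0 : ℝ) 1, a ≤ b → ℓ a ≤ ℓ b :=
    fun a ha b hb hab => le_self_add.trans_eq (hsub a ha b hb hab)
  have m0 : (0 : ℝ) ∈ Icc (0 : ℝ) 1 := ⟨le_rfl, zero_le_one⟩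
  have m1 : (1 : ℝ) ∈ Icc (0 : ℝ) 1 := ⟨zero_le_one, le_rfl⟩
  have hfin' : ∀ a ∈ Icc (0 : ℝ) 1, ℓ a ≠ ⊤ := fun a ha =>
    ne_top_of_le_ne_top hfin (hmono a ha 1 m1 ha.2)
  have hcont : ContinuousOn (fun t => (ℓ t).toReal) (Icc 0 1) := by
    obtain ⟨f, hf⟩ : ∃ f : ℝ → ℝ≥0∞, ∀ a b, arcLength l2Norm c a b = ∫⁻ t in Ioo a b, f t :=
      ⟨_, arcLength_eq_lintegral_Ioo l2Norm c⟩
    rw [Metric.continuousOn_iff]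
    intro x hx ε hε
    have hfin1 : ∫⁻ t in Ioo (0 : ℝ) 1, f t ≠ ⊤ := by rw [← hf]; exact hfin
    obtain ⟨δ, hδ, h⟩ := exists_pos_setLIntegral_lt_of_measure_lt hfin1
      (ENNReal.ofReal_pos.2 hε).ne'
    have main : ∀ a ∈ Icc (0 : ℝ) 1, ∀ b ∈ Icc (0 : ℝ) 1, a ≤ b → ENNReal.ofReal (b - a) < δ →
        dist (ℓ a).toReal (ℓ b).toReal < ε := by
      intro a ha b hb hab hlt
      have hsub' : Ioo a b ⊆ Ioo 0 1 := Ioo_subset_Ioo ha.1 hb.2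
      have h1 := h (Ioo a b) ((Measure.restrict_le_self _).trans_lt (by simpa using hlt))
      rw [Measure.restrict_restrict_of_subset hsub', ← hf] at h1
      have h2 : arcLength l2Norm c a b ≠ ⊤ := (h1.trans ENNReal.ofReal_lt_top).ne
      rw [← hsub a ha b hb hab, ENNReal.toReal_add (hfin' a ha) h2, Real.dist_eq, abs_sub_comm,
        add_sub_cancel_left, abs_of_nonneg ENNReal.toReal_nonneg]
      exact (ENNReal.lt_ofReal_iff_toReal_lt h2).1 h1
    have hlim : Tendsto (fun y : ℝ => ENNReal.ofReal |y - x|) (𝓝 x) (𝓝 0) := by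
      have : Continuous fun y : ℝ => ENNReal.ofReal |y - x| := ENNReal.continuous_ofReal.comp (by fun_prop)
      simpa using this.tendsto x
    obtain ⟨η, hη, hη'⟩ := Metric.eventually_nhds_iff.1 (hlim.eventually (gt_mem_nhds hδ))
    refine ⟨η, hη, fun y hy hyx => ?_⟩
    have h3 := hη' hyx
    rcases le_total x y with hxy | hxy
    · rw [dist_comm]
      refine main x hx y hy hxy ?_
      rwa [abs_of_nonneg (by linarith)] at h3
    · refine main y hy x hx hxy ?_
      rwa [abs_sub_comm, abs_of_nonneg (by linarith)] at h3
  have hℓ0 : ℓ 0 = 0 := by simp [hℓ, arcLength]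
  have hex : ∀ s : ℝ, ∃ t ∈ Icc (0 : ℝ) 1, 0 ≤ s →
      (ENNReal.ofReal s = ℓ t ∨ (t = 1 ∧ ℓ 1 ≤ ENNReal.ofReal s)) := by
    intro s
    by_cases hs : 0 ≤ s ∧ s ≤ (ℓ 1).toReal
    · obtain ⟨t, ht, hts⟩ := intermediate_value_Icc zero_le_one hcont
        (show s ∈ Icc (ℓ 0).toReal (ℓ 1).toReal from ⟨by simpa [hℓ0] using hs.1, hs.2⟩)
      refine ⟨t, ht, fun _ => Or.inl ?_⟩
      rw [← hts, ENNReal.ofReal_toReal (hfin' t ht)]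
    · refine ⟨1, m1, fun h => Or.inr ⟨rfl, ?_⟩⟩
      have : (ℓ 1).toReal < s := by
        by_contra h'
        exact hs ⟨h, not_lt.1 h'⟩
      rw [← ENNReal.ofReal_toReal hfin]
      exact ENNReal.ofReal_le_ofReal this.le
  choose τ hτ hτ' using hex
  set γ : ℝ → Fibre n p q := fun s => (hF (τ s) (hτ s)).toFibre with hγ
  have hle : ∀ a (ha : a ∈ Icc (0 : ℝ) 1) b (hb : b ∈ Icc (0 : ℝ) 1), a ≤ b →
      edist (hF a ha).toFibre (hF b hb).toFibre + ℓ a ≤ ℓ b := by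
    intro a ha b hb hab
    rw [← hsub a ha b hb hab, add_comm]
    gcongr
    exact l2Dist_le_arcLength hab (hc.contDiffOn.mono (Icc_subset_Icc ha.1 hb.2))
      fun t ht => hF t ⟨ha.1.trans ht.1, ht.2.trans hb.2⟩
  have hL0 : 0 < L := ENNReal.ofReal_pos.1 (lt_of_le_of_lt zero_le hL)
  have hW₀ : (hF 0 m0).toFibre = W₀ := Subtype.ext hc.source
  have hW₁ : (hF 1 m1).toFibre = W₁ := Subtype.ext hc.target
  have hlip : ∀ s s', 0 ≤ s → s ≤ s' → edist (γ s) (γ s') ≤ ENNReal.ofReal (s' - s) := by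
    intro s s' hs hss
    have hs' := hs.trans hss
    have key : ∀ {x : ℝ≥0∞}, x + ENNReal.ofReal s ≤ ENNReal.ofReal s' →
        x ≤ ENNReal.ofReal (s' - s) := fun h => by
      rw [ENNReal.ofReal_sub _ hs]
      exact ENNReal.le_sub_of_add_le_right ENNReal.ofReal_ne_top h
    have hup : ℓ (τ s') ≤ ENNReal.ofReal s' := by
      rcases hτ' s' hs' with h | ⟨h, h'⟩
      · exact h.ge
      · rwa [h]
    rcases hτ' s hs with h | ⟨h, h'⟩
    · rcases le_total (τ s) (τ s') with ht | ht
      · apply key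
        rw [h]
        exact (hle _ (hτ s) _ (hτ s') ht).trans hup
      · have h1 := hle _ (hτ s') _ (hτ s) ht
        have h2 : ENNReal.ofReal s ≤ ENNReal.ofReal s' := ENNReal.ofReal_le_ofReal hss
        rcases hτ' s' hs' with h3 | ⟨h3, h3'⟩
        · rw [← h3, ← h] at h1
          have h4 : edist (γ s') (γ s) + ENNReal.ofReal s' ≤ 0 + ENNReal.ofReal s' := by
            rw [zero_add]; exact h1.trans h2
          have h5 := ENNReal.le_of_add_le_add_right ENNReal.ofReal_ne_top h4
          rw [edist_comm]
          exact h5.trans zero_le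
        · have : τ s = τ s' := le_antisymm (by rw [h3]; exact (hτ s).2) ht
          simp [hγ, this]
    · rcases hτ' s' hs' with h3 | ⟨h3, -⟩
      · have h1 := hle _ (hτ s') _ (hτ s) (by rw [h]; exact (hτ s').2)
        rw [← h3] at h1
        have h4 : edist (γ s') (γ s) + ENNReal.ofReal s' ≤ 0 + ENNReal.ofReal s' := by
          rw [zero_add]
          refine h1.trans ?_
          rw [h]
          exact h'.trans (ENNReal.ofReal_le_ofReal hss)
        have h5 := ENNReal.le_of_add_le_add_right ENNReal.ofReal_ne_top h4
        rw [edist_comm]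
        exact h5.trans zero_le
      · have : τ s = τ s' := by rw [h, h3]
        simp [hγ, this]
  refine ⟨γ, ?_, ?_, fun s hs s' hs' => ?_⟩
  · rw [← hW₀]
    rcases hτ' 0 le_rfl with h | ⟨h, h'⟩
    · have h1 := hle 0 m0 _ (hτ 0) (hτ 0).1
      rw [← h, hℓ0, add_zero, ENNReal.ofReal_zero, nonpos_iff_eq_zero, edist_eq_zero] at h1
      exact h1.symm
    · have h1 := hle 0 m0 _ (hτ 0) (hτ 0).1
      rw [hℓ0, add_zero] at h1
      have h2 : edist (hF 0 m0).toFibre (γ 0) = 0 := by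
        refine le_antisymm (h1.trans ?_) zero_le
        rw [h]; simpa using h'
      exact (edist_eq_zero.1 h2).symm
  · rw [← hW₁]
    rcases hτ' L hL0.le with h | ⟨h, -⟩
    · exfalso
      have := hmono _ (hτ L) 1 m1 (hτ L).2
      rw [← h] at this
      exact absurd hl (not_lt.2 this)
    · simp [hγ, h]
  · rcases le_total s s' with h | h
    · rw [abs_sub_comm, abs_of_nonneg (by linarith)]
      exact hlip s s' hs.1 h
    · rw [edist_comm, abs_of_nonneg (by linarith)]
      exact hlip s' s hs'.1 h

end UpperBound

section LocalCompactness

variable {n : ℕ} {p q : OnePoint ℂ}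

theorem continuous_revCoeffs : Continuous (revCoeffs (n := n)) := by
  unfold revCoeffs
  fun_prop

theorem isClosed_endCond : IsClosed {c : Coeffs n | EndCond p q c} := by
  have h : ∀ r : OnePoint ℂ, Continuous fun c : Coeffs n => wedge (evalPair c 0) (homCoord r) :=
    fun r => continuous_wedge.comp ((continuous_evalPair.comp
      (by fun_prop : Continuous fun c : Coeffs n => (c, (0 : ℂ)))).prodMk continuous_const)
  exact (isClosed_eq (h p) continuous_const).inter
    (isClosed_eq ((h q).comp continuous_revCoeffs) continuous_const)

theorem ne_zero_of_hasDegree {c : Coeffs n} (hc : HasDegree c) : c ≠ 0 := by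
  rintro rfl
  have := hc.2
  simp at this

/-- The normalised coefficients satisfying the endpoint conditions. -/
def unitCoeffs (n : ℕ) (p q : OnePoint ℂ) : Set (Coeffs n) :=
  Metric.sphere 0 1 ∩ {c | EndCond p q c}

theorem isCompact_unitCoeffs : IsCompact (unitCoeffs n p q) :=
  (isCompact_sphere 0 1).inter_right isClosed_endCond

theorem ne_zero_of_mem_unitCoeffs {c : Coeffs n} (hc : c ∈ unitCoeffs n p q) : c ≠ 0 := by
  rintro rfl
  simpa using hc.1

theorem continuousOn_sepInt {c : Coeffs n} (hc : c ≠ 0) :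
    ContinuousOn (sepInt c) (unitCoeffs n p q) := fun _ hd =>
  (continuousAt_sepInt c hc (ne_zero_of_mem_unitCoeffs hd)).continuousWithinAt

theorem exists_pos_le_sepInt {c : Coeffs n} (hc : HasDegree c) :
    ∃ μ > 0, μ ≠ ⊤ ∧ ∀ d ∈ unitCoeffs n p q, ¬ HasDegree d → μ ≤ sepInt c d := by
  have hD : IsCompact (unitCoeffs n p q ∩ {d | HasDegree d}ᶜ) :=
    isCompact_unitCoeffs.inter_right isOpen_hasDegree.isClosed_compl
  rcases (unitCoeffs n p q ∩ {d | HasDegree d}ᶜ).eq_empty_or_nonempty with h | h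
  · refine ⟨1, one_pos, ENNReal.one_ne_top, fun d hd hd' => ?_⟩
    have : d ∈ (∅ : Set (Coeffs n)) := h ▸ ⟨hd, hd'⟩
    exact this.elim
  · obtain ⟨d, hd, hmin⟩ := hD.exists_isMinOn h
      ((continuousOn_sepInt (ne_zero_of_hasDegree hc)).mono inter_subset_left)
    refine ⟨min 1 (sepInt c d), lt_min one_pos ?_, ne_top_of_le_ne_top ENNReal.one_ne_top
      (min_le_left _ _), fun e he he' => (min_le_right _ _).trans (hmin ⟨he, he'⟩)⟩
    refine pos_iff_ne_zero.2 fun h0 => ?_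
    obtain ⟨a, ha⟩ := exists_smul_of_sepInt_eq_zero hc h0
    have ha0 : a ≠ 0 := by
      rintro rfl
      exact ne_zero_of_mem_unitCoeffs hd.1 (by simpa using ha)
    exact hd.2 (by rw [ha]; exact hc.smul ha0)

theorem exists_mem_unitCoeffs (W : Fibre n p q) :
    ∃ c, ∃ h : InFibre p q c, c ∈ unitCoeffs n p q ∧ h.toFibre = W := by
  obtain ⟨c, hc, rfl⟩ := exists_inFibre W
  have h0 : ‖c‖ ≠ 0 := norm_ne_zero_iff.2 (ne_zero_of_hasDegree hc.1)
  have h1 : ((‖c‖⁻¹ : ℝ) : ℂ) ≠ 0 := by simpa using ne_zero_of_hasDegree hc.1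
  refine ⟨((‖c‖⁻¹ : ℝ) : ℂ) • c, hc.smul h1, ⟨?_, (inFibre_iff.1 (hc.smul h1)).2⟩,
    Subtype.ext (lumpMap_smul h1 c)⟩
  rw [mem_sphere_zero_iff_norm, norm_smul, Complex.norm_real, norm_inv, norm_norm,
    inv_mul_cancel₀ h0]

instance : LocallyCompactSpace (Fibre n p q) := by
  suffices WeaklyLocallyCompactSpace (Fibre n p q) from inferInstance
  refine ⟨fun W => ?_⟩
  obtain ⟨c, hc, -, rfl⟩ := exists_mem_unitCoeffs W
  obtain ⟨μ, hμ, hμt, hD⟩ := exists_pos_le_sepInt (p := p) (q := q) hc.1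
  set K : Set (Coeffs n) := unitCoeffs n p q ∩ sepInt c ⁻¹' Iic (μ / 2)
  have hKc : IsCompact K := isCompact_unitCoeffs.of_isClosed_subset
    ((continuousOn_sepInt (ne_zero_of_hasDegree hc.1)).preimage_isClosed_of_isClosed
      isCompact_unitCoeffs.isClosed isClosed_Iic) inter_subset_left
  have hKF : ∀ d ∈ K, InFibre p q d := fun d hd => inFibre_iff.2 ⟨by
    by_contra h
    have h1 := (hD d hd.1 h).trans hd.2
    exact absurd (ENNReal.half_lt_self hμ.ne' hμt) (not_lt.2 h1), hd.1.2⟩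
  have hK' : IsCompact (Subtype.val ⁻¹' K : Set {c : Coeffs n // InFibre p q c}) := by
    have hind : Topology.IsInducing (Subtype.val : {c : Coeffs n // InFibre p q c} → Coeffs n) :=
      ⟨rfl⟩
    exact (hind.isCompact_preimage_iff fun d hd => ⟨⟨d, hKF d hd⟩, rfl⟩).2 hKc
  refine ⟨_, hK'.image continuous_toFibre, ?_⟩
  have hε : 0 < μ / 2 / sepConst :=
    ENNReal.div_pos (ENNReal.half_pos hμ.ne').ne' sepConst_ne_top
  refine mem_of_superset (Metric.eball_mem_nhds _ hε) fun W' hW' => ?_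
  obtain ⟨c', hc', hu, rfl⟩ := exists_mem_unitCoeffs W'
  refine ⟨⟨c', hc'⟩, ⟨hu, ?_⟩, rfl⟩
  rw [Metric.mem_eball, edist_comm, edist_eq_l2Dist] at hW'
  calc sepInt c c' ≤ sepConst * l2Dist hc.toFibre hc'.toFibre := sepInt_le_l2Dist hc hc'
    _ ≤ sepConst * (μ / 2 / sepConst) := by gcongr
    _ ≤ μ / 2 := ENNReal.mul_div_le

end LocalCompactness

section Example

variable {n : ℕ} {p q : OnePoint ℂ}

/-- The polynomial `f`, of degree at most `n`, times the vector `u`. -/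
def polyVec (n : ℕ) (f : Polynomial ℂ) (u : ℂ × ℂ) : Coeffs n :=
  (u.1 • ofPoly n f, u.2 • ofPoly n f)

theorem evalPair_polyVec {f : Polynomial ℂ} (hf : f.natDegree ≤ n) (u : ℂ × ℂ) (w : ℂ) :
    evalPair (polyVec n f u) w = f.eval w • u := by
  ext <;> simp [evalPair, polyVec, toPoly_smul, toPoly_ofPoly hf, mul_comm]

theorem evalPair_revCoeffs_polyVec (f : Polynomial ℂ) (u : ℂ × ℂ) :
    evalPair (revCoeffs (polyVec n f u)) 0 = f.coeff n • u := by
  rw [evalPair_revCoeffs_zero]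
  ext <;> simp [polyVec, ofPoly, mul_comm]

theorem nsq_smul (a : ℂ) (u : ℂ × ℂ) : nsq (a • u) = ‖a‖ ^ 2 * nsq u := by
  simp [nsq, mul_pow, mul_add]

theorem le_nsq_smul_add_smul {u v : ℂ × ℂ} (h : wedge u v ≠ 0) :
    ∃ m > 0, ∀ a b : ℂ, m * (‖a‖ ^ 2 + ‖b‖ ^ 2) ≤ nsq (a • u + b • v) := by
  have hu : 0 < nsq u := nsq_pos fun h0 => h (by simp [h0, wedge])
  have hv : 0 < nsq v := nsq_pos fun h0 => h (by simp [h0, wedge])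
  have hw : 0 < ‖wedge u v‖ := norm_pos_iff.2 h
  refine ⟨‖wedge u v‖ ^ 2 / (nsq u + nsq v), by positivity, fun a b => ?_⟩
  have h1 := norm_wedge_sq_le (a • u + b • v) v
  have h2 := norm_wedge_sq_le (a • u + b • v) u
  have e1 : wedge (a • u + b • v) v = a * wedge u v := by simp [wedge]; ring
  have e2 : wedge (a • u + b • v) u = -(b * wedge u v) := by simp [wedge]; ring
  rw [e1, norm_mul, mul_pow] at h1
  rw [e2, norm_neg, norm_mul, mul_pow] at h2
  rw [div_mul_eq_mul_div, div_le_iff₀ (by positivity)]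
  linarith

/-- The integrand dominating the energy density near a bubble. -/
def bubbleBound (n : ℕ) (x : ℝ) : ℝ≥0∞ :=
  if x = 0 then ⊤ else ENNReal.ofReal (Real.exp (x / (2 * n)) / √|Real.exp x - 1|)

theorem measurable_bubbleBound : Measurable (bubbleBound n) := by
  unfold bubbleBound
  refine Measurable.ite (measurableSet_singleton 0) measurable_const ?_
  fun_prop

theorem div_le_one_sub_exp_neg {a : ℝ} (ha : 0 < a) : a / (1 + a) ≤ 1 - Real.exp (-a) := by
  have h := Real.add_one_le_exp a
  rw [Real.exp_neg, div_le_iff₀ (by positivity)]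
  have h1 : (Real.exp a)⁻¹ * (1 + a) ≤ 1 := by
    rw [inv_mul_le_iff₀ (Real.exp_pos a)]; linarith
  linarith

theorem exp_div_sqrt_le (hn : 2 ≤ n) {x : ℝ} (hx : x ≠ 0) :
    Real.exp (x / (2 * n)) / √|Real.exp x - 1| ≤
      Real.exp (-((1 / (2 * n)) * |x|)) * (1 + |x| ^ (-(1 / 2) : ℝ)) := by
  have hn0 : (2 : ℝ) ≤ n := by exact_mod_cast hn
  have ha : 0 < |x| := abs_pos.2 hx
  have hq : 0 < |x| / (1 + |x|) := by positivity
  have hsq : 1 / √(|x| / (1 + |x|)) ≤ 1 + |x| ^ (-(1 / 2) : ℝ) := by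
    have h1 : |x| ^ (-(1 / 2) : ℝ) = 1 / √|x| := by
      rw [Real.rpow_neg ha.le, ← Real.sqrt_eq_rpow, one_div]
    rw [h1, Real.sqrt_div ha.le, one_div_div]
    have h2 : √(1 + |x|) ≤ 1 + √|x| := by
      rw [Real.sqrt_le_left (by positivity)]
      nlinarith [Real.sq_sqrt ha.le, Real.sqrt_nonneg |x|]
    have h3 : 0 < √|x| := Real.sqrt_pos.2 ha
    rw [div_le_iff₀ h3, add_mul, one_mul, one_div_mul_cancel h3.ne']
    linarith
  have hinv : 1 / (2 * (n : ℝ)) ≤ 1 / 4 := by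
    apply one_div_le_one_div_of_le <;> linarith
  rcases lt_or_gt_of_ne hx with h | h
  · have h0 : |Real.exp x - 1| = 1 - Real.exp (-|x|) := by
      rw [abs_of_neg h, neg_neg, abs_of_nonpos (by have := Real.exp_le_one_iff.2 h.le; linarith)]
      ring
    have h1 : |x| / (1 + |x|) ≤ |Real.exp x - 1| := h0 ▸ div_le_one_sub_exp_neg ha
    have e1 : x / (2 * n) = -((1 / (2 * n)) * |x|) := by rw [abs_of_neg h]; ring
    rw [e1, div_eq_mul_one_div]
    gcongr
    refine le_trans ?_ hsq
    gcongr
  · have h0 : |Real.exp x - 1| = Real.exp x * (1 - Real.exp (-|x|)) := by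
      rw [abs_of_pos h, mul_sub, ← Real.exp_add, add_neg_cancel, Real.exp_zero, mul_one,
        abs_of_nonneg (by have := Real.one_le_exp h.le; linarith)]
    have h1 : Real.exp x * (|x| / (1 + |x|)) ≤ |Real.exp x - 1| := by
      rw [h0]; gcongr; exact div_le_one_sub_exp_neg ha
    have h2 : √(Real.exp x) * √(|x| / (1 + |x|)) ≤ √|Real.exp x - 1| := by
      rw [← Real.sqrt_mul (Real.exp_pos x).le]
      exact Real.sqrt_le_sqrt h1
    have h3 : √(Real.exp x) = Real.exp (x / 2) := by rw [← Real.exp_half]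
    have h4 : 0 < √(|x| / (1 + |x|)) := Real.sqrt_pos.2 hq
    calc _ ≤ Real.exp (x / (2 * n)) / (√(Real.exp x) * √(|x| / (1 + |x|))) := by
          gcongr
      _ = Real.exp (x / (2 * n) - x / 2) * (1 / √(|x| / (1 + |x|))) := by
          rw [h3, Real.exp_sub]; field_simp
      _ ≤ _ := by
          refine mul_le_mul (Real.exp_le_exp.2 ?_) hsq (by positivity) (Real.exp_pos _).le
          rw [abs_of_pos h]
          have : x / (2 * n) = 1 / (2 * n) * x := by ring
          rw [this]
          nlinarith

theorem lintegral_bubbleBound_lt_top (hn : 2 ≤ n) : ∫⁻ x, bubbleBound n x < ⊤ := by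
  set s : ℝ := 1 / (2 * n) with hs
  have hn0 : (2 : ℝ) ≤ n := by exact_mod_cast hn
  have hs0 : 0 < s := by positivity
  set g : ℝ → ℝ := fun x => Real.exp (-(s * |x|)) * (1 + |x| ^ (-(1 / 2) : ℝ)) with hg
  have hpos : IntegrableOn g (Ioi 0) := by
    have h1 : IntegrableOn (fun x : ℝ => x ^ (0 : ℝ) * Real.exp (-s * x ^ (1 : ℝ))) (Ioi 0) :=
      integrableOn_rpow_mul_exp_neg_mul_rpow (by norm_num) one_pos hs0
    have h2 : IntegrableOn (fun x : ℝ => x ^ (-(1 / 2) : ℝ) * Real.exp (-s * x ^ (1 : ℝ))) (Ioi 0) :=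
      integrableOn_rpow_mul_exp_neg_mul_rpow (by norm_num) one_pos hs0
    refine (h1.add h2).congr_fun (fun x hx => ?_) measurableSet_Ioi
    simp only [hg, abs_of_pos (mem_Ioi.1 hx), Pi.add_apply, Real.rpow_zero, Real.rpow_one]
    ring_nf
  have hneg : IntegrableOn g (Iio 0) := by
    have h1 := hpos
    rw [← integrable_indicator_iff measurableSet_Ioi] at h1
    rw [← integrable_indicator_iff measurableSet_Iio]
    refine h1.comp_neg.congr (Eventually.of_forall fun x => ?_)
    by_cases hx : x < 0 <;> simp [indicator, hx, hg]
  have hgi : IntegrableOn g (Ioi 0 ∪ Iio 0) := hpos.union hneg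
  have hae : ∀ᵐ x : ℝ, x ≠ 0 := compl_mem_ae_iff.2 (measure_singleton 0)
  have hset : (Ioi 0 ∪ Iio 0 : Set ℝ) =ᵐ[volume] univ := by
    filter_upwards [hae] with x hx
    have : x ∈ (Ioi 0 ∪ Iio 0 : Set ℝ) := (lt_or_gt_of_ne hx).symm
    exact propext ⟨fun _ => trivial, fun _ => this⟩
  have hgi' : Integrable g := by
    rw [← integrableOn_univ]
    exact hgi.congr_set_ae hset.symm
  refine lt_of_le_of_lt (lintegral_mono_ae ?_) hgi'.lintegral_lt_top
  filter_upwards [hae] with x hx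
  rw [bubbleBound, if_neg hx]
  exact ENNReal.ofReal_le_ofReal (exp_div_sqrt_le hn hx)

end Example

section Bubble

variable {n : ℕ} {p q : OnePoint ℂ}

theorem mul_pow_le_of_le {ρ η κ D : ℝ} {N : ℕ} (hρ : 0 ≤ ρ) (hη : 0 ≤ η) (hκ : 0 ≤ κ) (hN : 1 ≤ N)
    (h1 : κ * ρ ^ N ≤ D) (h2 : κ * η ^ N ≤ D) : κ * ρ * η ^ N ≤ η * D := by
  rcases le_total ρ η with h | h
  · calc κ * ρ * η ^ N = ρ * (κ * η ^ N) := by ring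
      _ ≤ η * D := mul_le_mul h h2 (by positivity) hη
  · obtain ⟨M, rfl⟩ := Nat.exists_eq_add_of_le hN
    calc κ * ρ * η ^ (1 + M) = κ * ρ * η * η ^ M := by ring
      _ ≤ κ * ρ * η * ρ ^ M := by gcongr
      _ = η * (κ * ρ ^ (1 + M)) := by ring
      _ ≤ η * D := by gcongr

/-- The `L²` mass of the bubble bound. -/
def bubbleConst (n : ℕ) : ℝ≥0∞ :=
  ∫⁻ z in {z : ℂ | z.im ∈ Ioc (-Real.pi) Real.pi}, bubbleBound n z.re

theorem bubbleConst_lt_top (hn : 2 ≤ n) : bubbleConst n < ⊤ := by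
  have h := setLIntegral_strip_mul (measurable_bubbleBound (n := n)) (g := fun _ => 1)
    measurable_const
  simp only [mul_one] at h
  rw [bubbleConst, h]
  exact ENNReal.mul_lt_top (lintegral_bubbleBound_lt_top hn) (by simp)

theorem ofReal_density_le_bubbleBound (hn : 2 ≤ n) {c v : Coeffs n} {e : ℂ × ℂ}
    (hv : ∀ w, evalPair v w = w • e) {κ θ : ℝ} (hκ : 0 < κ) (hθ : 0 < θ)
    (h1 : ∀ w, κ * ‖w - 1‖ ^ (2 * n) ≤ nsq (evalPair c w))
    (h2 : ∀ w, κ * (θ ^ (4 * n) * ‖w‖) ^ 2 ≤ nsq (evalPair c w)) (z : ℂ) :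
    ENNReal.ofReal (density c v z) ≤
      ENNReal.ofReal (4 * nsq e / κ * (θ / θ ^ (4 * n)) ^ 2) * bubbleBound n z.re := by
  by_cases he : e = 0
  · have : density c v z = 0 := by
      rw [density_eq_wedge, hv, he]; simp [wedge]
    simp [this]
  have hE : 0 < nsq e := nsq_pos he
  rw [bubbleBound]
  split_ifs with hz
  · rw [ENNReal.mul_top (by rw [ne_eq, ENNReal.ofReal_eq_zero, not_le]; positivity)]
    exact le_top
  rw [← ENNReal.ofReal_mul (by positivity)]
  apply ENNReal.ofReal_le_ofReal
  set w := Complex.exp z with hw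
  set x := z.re with hx
  have hn0 : (0 : ℝ) < n := by exact_mod_cast (by omega : 0 < n)
  have hwn : ‖w‖ = Real.exp x := Complex.norm_exp z
  have hex : 0 < |Real.exp x - 1| := abs_pos.2 fun h => hz (Real.exp_eq_one_iff x |>.1 (by linarith))
  have hr : |Real.exp x - 1| ≤ ‖w - 1‖ := by
    have := abs_norm_sub_norm_le w 1
    rwa [hwn, norm_one] at this
  have hr0 : 0 < ‖w - 1‖ := hex.trans_le hr
  have hD : 0 < nsq (evalPair c w) := lt_of_lt_of_le (by positivity) (h1 w)
  set D := nsq (evalPair c w) with hDdef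
  set η : ℝ := θ ^ 2 * Real.exp (x / (2 * n)) with hη
  have hη0 : 0 < η := by positivity
  have hηpow : η ^ (4 * n) = (θ ^ (4 * n)) ^ 2 * Real.exp x ^ 2 := by
    rw [hη, mul_pow, ← pow_mul, ← pow_mul, ← Real.exp_nat_mul, ← Real.exp_nat_mul]
    congr 2
    · ring
    · push_cast; field_simp; ring
  have k1 : κ * (√‖w - 1‖) ^ (4 * n) ≤ D := by
    rw [show 4 * n = 2 * (2 * n) by ring, pow_mul, Real.sq_sqrt (norm_nonneg _)]
    exact h1 w
  have k2 : κ * η ^ (4 * n) ≤ D := by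
    rw [hηpow, ← mul_pow, ← hwn]
    exact h2 w
  have key := mul_pow_le_of_le (Real.sqrt_nonneg _) hη0.le hκ.le (by omega) k1 k2
  have key' : κ * √|Real.exp x - 1| * η ^ (4 * n) ≤ η * D :=
    le_trans (by gcongr) key
  have hdens : density c v z ≤ 4 * (Real.exp x ^ 2 * nsq e) / D := by
    rw [density_eq_wedge, ← hw, hv, div_pow, div_le_div_iff₀ (by positivity) hD, mul_pow]
    have hwe := norm_wedge_sq_le (evalPair c w) (w • e)
    rw [nsq_smul, hwn, ← hDdef] at hwe
    calc _ ≤ 2 ^ 2 * (D * (Real.exp x ^ 2 * nsq e)) * D := by gcongr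
      _ = _ := by ring
  refine hdens.trans ?_
  have hs0 : 0 < √|Real.exp x - 1| := Real.sqrt_pos.2 hex
  rw [hηpow] at key'
  rw [div_le_iff₀ hD]
  have hfin : Real.exp x ^ 2 ≤ η * D / (κ * √|Real.exp x - 1| * (θ ^ (4 * n)) ^ 2) := by
    rw [le_div_iff₀ (by positivity)]
    linarith
  calc 4 * (Real.exp x ^ 2 * nsq e) ≤
        4 * (η * D / (κ * √|Real.exp x - 1| * (θ ^ (4 * n)) ^ 2) * nsq e) := by gcongr
    _ = _ := by rw [hη]; field_simp

theorem l2Norm_le_bubble (hn : 2 ≤ n) {c v : Coeffs n} {e : ℂ × ℂ}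
    (hv : ∀ w, evalPair v w = w • e) {κ θ : ℝ} (hκ : 0 < κ) (hθ : 0 < θ)
    (h1 : ∀ w, κ * ‖w - 1‖ ^ (2 * n) ≤ nsq (evalPair c w))
    (h2 : ∀ w, κ * (θ ^ (4 * n) * ‖w‖) ^ 2 ≤ nsq (evalPair c w)) :
    l2Norm c v ≤ ENNReal.ofReal (√(4 * nsq e / κ) * (θ / θ ^ (4 * n))) *
      bubbleConst n ^ (1 / 2 : ℝ) := by
  have hE := nsq_nonneg e
  have h : l2NormSq c v ≤
      ENNReal.ofReal (√(4 * nsq e / κ) * (θ / θ ^ (4 * n))) ^ 2 * bubbleConst n := by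
    rw [l2NormSq, bubbleConst, ← lintegral_const_mul' _ _ (by finiteness)]
    refine lintegral_mono fun z => ?_
    rw [← ENNReal.ofReal_pow (by positivity), mul_pow, Real.sq_sqrt (by positivity)]
    exact ofReal_density_le_bubbleBound hn hv hκ hθ h1 h2 z
  rw [l2Norm]
  refine (ENNReal.rpow_le_rpow h (by norm_num)).trans_eq ?_
  rw [ENNReal.mul_rpow_of_nonneg _ _ (by norm_num), ← ENNReal.rpow_natCast, ← ENNReal.rpow_mul]
  norm_num

/-- A line of lumps along which a bubble shrinks at `w = 1` reaches the boundary of the moduli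
space at finite distance. -/
theorem not_cauchyComplete_of_bubble (hn : 2 ≤ n) {c v : Coeffs n} {e : ℂ × ℂ}
    (hv : ∀ w, evalPair v w = w • e) {κ : ℝ} (hκ : 0 < κ)
    (hle : ∀ t ∈ Ioc (0 : ℝ) 1, ∀ w,
      κ * (‖w - 1‖ ^ (2 * n) + (t * ‖w‖) ^ 2) ≤ nsq (evalPair (c + t • v) w))
    (hvr : evalPair (revCoeffs v) 0 = 0) (hc : EndCond p q c)
    (hcr : evalPair (revCoeffs c) 0 ≠ 0) (hc1 : evalPair c 1 = 0) :
    ¬ CauchyComplete (l2Dist : Fibre n p q → Fibre n p q → ℝ≥0∞) := by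
  have h1 : ∀ t ∈ Ioc (0 : ℝ) 1, ∀ w, κ * ‖w - 1‖ ^ (2 * n) ≤ nsq (evalPair (c + t • v) w) :=
    fun t ht w => le_trans (by gcongr; linarith [sq_nonneg (t * ‖w‖)]) (hle t ht w)
  have h2 : ∀ t ∈ Ioc (0 : ℝ) 1, ∀ w, κ * (t * ‖w‖) ^ 2 ≤ nsq (evalPair (c + t • v) w) :=
    fun t ht w => by
      have : 0 ≤ ‖w - 1‖ ^ (2 * n) := by positivity
      exact le_trans (by gcongr; linarith) (hle t ht w)
  have h0 : c ≠ 0 := by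
    rintro rfl
    exact hcr (by simp [evalPair_zero, revCoeffs])
  have hF : ∀ t ∈ Ioc (0 : ℝ) 1, InFibre p q (c + t • v) := fun t ht => by
    have hend : EndCond p q (c + t • v) := by
      rw [← Complex.coe_smul]
      refine hc.add (EndCond.smul ⟨?_, ?_⟩ _)
      · rw [hv, zero_smul]; simp [wedge]
      · rw [hvr]; simp [wedge]
    refine inFibre_iff.2 ⟨hasDegree_iff.2 ⟨fun w hw0 => ?_, ?_⟩, hend⟩
    · have h := hle t ht w
      rw [hw0, show nsq (0 : ℂ × ℂ) = 0 by simp [nsq]] at h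
      have h4 : 0 < κ * (‖w - 1‖ ^ (2 * n) + (t * ‖w‖) ^ 2) := by
        by_cases hw : w = 1
        · have := ht.1
          rw [hw, norm_one]
          positivity
        · have : 0 < ‖w - 1‖ := norm_pos_iff.2 (sub_ne_zero.2 hw)
          positivity
      linarith
    · rwa [← Complex.coe_smul, revCoeffs_add, revCoeffs_smul, evalPair_add, evalPair_smul, hvr,
        smul_zero, add_zero]
  intro hcomp
  set θ : ℕ → ℝ := fun k => (1 / 2) ^ k with hθ
  have hθ0 : ∀ k, 0 < θ k := fun k => by positivity
  have hθ1 : ∀ k, θ k ≤ 1 := fun k => pow_le_one₀ (by norm_num) (by norm_num)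
  set t : ℕ → ℝ := fun k => θ k ^ (4 * n) with ht
  have ht0 : ∀ k, t k ∈ Ioc (0 : ℝ) 1 := fun k =>
    ⟨pow_pos (hθ0 k) _, pow_le_one₀ (hθ0 k).le (hθ1 k)⟩
  have hθs : ∀ k, θ (k + 1) = θ k / 2 := fun k => by simp only [hθ, pow_succ]; ring
  set u : ℕ → Fibre n p q := fun k => (hF (t k) (ht0 k)).toFibre with hu
  set C : ℝ := √(4 * nsq e / κ) * 2 ^ (4 * n) / 2 with hC
  have hC0 : 0 ≤ C := by positivity
  have hstep : ∀ k, edist (u k) (u (k + 1)) ≤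
      ENNReal.ofReal C * bubbleConst n ^ (1 / 2 : ℝ) / 2 ^ k := by
    intro k
    have hle : t (k + 1) ≤ t k := by
      simp only [ht, hθs]
      exact pow_le_pow_left₀ (by have := hθ0 k; positivity) (by linarith [hθ0 k]) _
    have hmem : ∀ s ∈ Icc (t (k + 1)) (t k), s ∈ Ioc (0 : ℝ) 1 := fun s hs =>
      ⟨(ht0 _).1.trans_le hs.1, hs.2.trans (ht0 k).2⟩
    have h := edist_le_of_line hle (fun s hs => hF s (hmem s hs)) (fun s hs =>
      l2Norm_le_bubble hn hv hκ (hθ0 (k + 1)) (h1 s (hmem s hs)) (fun w => by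
        refine le_trans ?_ (h2 s (hmem s hs) w)
        have : θ (k + 1) ^ (4 * n) ≤ s := hs.1
        have := hθ0 (k + 1)
        gcongr))
    rw [edist_comm]
    refine h.trans ?_
    have hpow : ENNReal.ofReal (θ k) = ((2 : ℝ≥0∞) ^ k)⁻¹ := by
      simp only [hθ]
      rw [ENNReal.ofReal_pow (by norm_num), one_div, ENNReal.ofReal_inv_of_pos two_pos,
        ENNReal.ofReal_ofNat, ENNReal.inv_pow]
    rw [div_eq_mul_inv (ENNReal.ofReal C * _), ← hpow, mul_right_comm, mul_right_comm (ENNReal.ofReal C),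
      ← ENNReal.ofReal_mul hC0, ← ENNReal.ofReal_mul (by have := hθ0 (k + 1); positivity)]
    gcongr ENNReal.ofReal ?_ * _
    have hk := hθ0 k
    calc _ ≤ √(4 * nsq e / κ) * (θ (k + 1) / θ (k + 1) ^ (4 * n)) * t k := by
          have := hθ0 (k + 1)
          gcongr ?_ * ?_
          linarith [(ht0 (k + 1)).1]
      _ = C * θ k := by
          simp only [hC, ht, hθs, div_pow]
          field_simp
  have hCtop : ENNReal.ofReal C * bubbleConst n ^ (1 / 2 : ℝ) ≠ ⊤ :=
    ENNReal.mul_ne_top ENNReal.ofReal_ne_top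
      (ENNReal.rpow_ne_top_of_nonneg (by norm_num) (bubbleConst_lt_top hn).ne)
  have hcs : CauchySeq u := cauchySeq_of_edist_le_geometric_two _ hCtop hstep
  obtain ⟨W, hW⟩ := hcomp u (EMetric.cauchySeq_iff.1 hcs)
  obtain ⟨d, hd, rfl⟩ := exists_inFibre W
  have htend : Tendsto t atTop (𝓝 0) := by
    have : ∀ k, t k = ((1 / 2 : ℝ) ^ (4 * n)) ^ k := fun k => by
      simp only [ht, hθ]; rw [← pow_mul, ← pow_mul, mul_comm]
    rw [funext this]
    exact tendsto_pow_atTop_nhds_zero_of_lt_one (by positivity)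
      (pow_lt_one₀ (by norm_num) (by norm_num) (by omega))
  have hct : Tendsto (fun k => c + t k • v) atTop (𝓝 c) := by
    simpa using tendsto_const_nhds.add (htend.smul_const v)
  have s1 : Tendsto (fun k => sepInt d (c + t k • v)) atTop (𝓝 (sepInt d c)) :=
    (continuousAt_sepInt d (ne_zero_of_hasDegree hd.1) h0).tendsto.comp hct
  have s2 : Tendsto (fun k => sepInt d (c + t k • v)) atTop (𝓝 0) := by
    have hlim : Tendsto (fun k => sepConst * l2Dist (u k) hd.toFibre) atTop (𝓝 0) := by
      simpa using ENNReal.Tendsto.const_mul hW (Or.inr sepConst_ne_top)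
    refine tendsto_of_tendsto_of_tendsto_of_le_of_le tendsto_const_nhds hlim
      (fun _ => zero_le) fun k => ?_
    rw [l2Dist_comm]
    exact sepInt_le_l2Dist hd (hF (t k) (ht0 k))
  obtain ⟨a, ha⟩ := exists_smul_of_sepInt_eq_zero hd.1 (tendsto_nhds_unique s1 s2)
  have ha0 : a ≠ 0 := by
    rintro rfl
    exact h0 (by simpa using ha)
  exact evalPair_ne_zero (hd.1.smul ha0) 1 (ha ▸ hc1)

theorem not_cauchyComplete_of_eq (hn : 2 ≤ n) (p : OnePoint ℂ) :
    ¬ CauchyComplete (l2Dist : Fibre n p p → Fibre n p p → ℝ≥0∞) := by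
  obtain ⟨r, hr⟩ : ∃ r : OnePoint ℂ, p ≠ r := (exists_ne p).imp fun _ h => h.symm
  obtain ⟨m, hm, hle⟩ := le_nsq_smul_add_smul (wedge_homCoord_ne_zero hr)
  set f : Polynomial ℂ := (Polynomial.X - Polynomial.C 1) ^ n with hf
  have hfm : f.Monic := (Polynomial.monic_X_sub_C 1).pow n
  have hfd : f.natDegree = n := by
    rw [hf, Polynomial.natDegree_pow, Polynomial.natDegree_X_sub_C, mul_one]
  have hfe : ∀ w, f.eval w = (w - 1) ^ n := fun w => by simp [hf]
  have hX : (Polynomial.X : Polynomial ℂ).natDegree ≤ n := by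
    rw [Polynomial.natDegree_X]; omega
  set c := polyVec n f (homCoord p) with hc
  set v := polyVec n Polynomial.X (homCoord r) with hv
  have hce : ∀ w, evalPair c w = (w - 1) ^ n • homCoord p := fun w => by
    rw [hc, evalPair_polyVec hfd.le, hfe]
  have hve : ∀ w, evalPair v w = w • homCoord r := fun w => by
    rw [hv, evalPair_polyVec hX, Polynomial.eval_X]
  have hcr : evalPair (revCoeffs c) 0 = homCoord p := by
    rw [hc, evalPair_revCoeffs_polyVec, ← hfd, hfm.coeff_natDegree, one_smul]
  have hvr : evalPair (revCoeffs v) 0 = 0 := by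
    rw [hv, evalPair_revCoeffs_polyVec, Polynomial.coeff_X_of_ne_one (by omega), zero_smul]
  have hcv : ∀ (t : ℝ) w, evalPair (c + t • v) w = (w - 1) ^ n • homCoord p +
      ((t : ℂ) * w) • homCoord r := fun t w => by
    rw [← Complex.coe_smul, evalPair_add, evalPair_smul, hce, hve, smul_smul]
  have hn1 : ∀ (t : ℝ) (w : ℂ), 0 ≤ t → m * (‖w - 1‖ ^ (2 * n) + (t * ‖w‖) ^ 2) ≤
      nsq (evalPair (c + t • v) w) := fun t w ht => by
    have := hle ((w - 1) ^ n) (t * w)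
    rwa [norm_pow, norm_mul, Complex.norm_real, Real.norm_of_nonneg ht, ← pow_mul, mul_comm n,
      ← hcv] at this
  refine not_cauchyComplete_of_bubble (c := c) hn hve hm (fun t ht w => hn1 t w ht.1.le) hvr ⟨?_, ?_⟩ ?_ ?_
  · rw [hce, wedge_smul_left, wedge_self, mul_zero]
  · rw [hcr, wedge_self]
  · rw [hcr]; exact homCoord_ne_zero p
  · rw [hce, sub_self, zero_pow (by omega), zero_smul]

theorem bubble_bound_of_ne (hn : 2 ≤ n) {t : ℝ} (ht : t ∈ Ioc (0 : ℝ) 1) (w : ℂ) :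
    1 / (8 * 9 ^ n) * (‖w - 1‖ ^ (2 * n) + (t * ‖w‖) ^ 2) ≤
      ‖-(w - 1) + t * w‖ ^ 2 + ‖(w - 1) * w ^ (n - 1)‖ ^ 2 := by
  have ht0 := ht.1
  have ht1 := ht.2
  have htw : ‖(t : ℂ) * w‖ = t * ‖w‖ := by
    rw [norm_mul, Complex.norm_real, Real.norm_of_nonneg ht0.le]
  have hr3 : ‖w - 1‖ ≤ ‖w‖ + 1 := by simpa using norm_sub_le w 1
  have hN : (1 : ℝ) ≤ 9 ^ n := one_le_pow₀ (by norm_num)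
  obtain ⟨k, rfl⟩ : ∃ k, n = k + 1 := ⟨n - 1, by omega⟩
  rw [Nat.add_sub_cancel, one_div, inv_mul_le_iff₀ (by positivity)]
  set a := ‖-(w - 1) + t * w‖ with ha
  set b := ‖(w - 1) * w ^ k‖ with hb
  have hbe : b = ‖w - 1‖ * ‖w‖ ^ k := by rw [hb, norm_mul, norm_pow]
  rcases le_total (1 / 2) ‖w‖ with hw | hw
  · have e1 : ‖w - 1‖ ≤ 2 ^ k * b := by
      have : 1 ≤ 2 ^ k * ‖w‖ ^ k := by
        rw [← mul_pow]; exact one_le_pow₀ (by linarith)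
      rw [hbe]
      nlinarith [norm_nonneg (w - 1)]
    have e2 : ‖w - 1‖ ^ (k + 1) ≤ 3 ^ k * b := by
      rw [hbe, pow_succ]
      have : ‖w - 1‖ ^ k ≤ (3 * ‖w‖) ^ k := by gcongr; linarith
      rw [mul_pow] at this
      nlinarith [norm_nonneg (w - 1)]
    have e3 : t * ‖w‖ ≤ a + ‖w - 1‖ := by
      rw [← htw, ha]
      have := norm_add_le (-(w - 1) + t * w) (w - 1)
      rwa [show -(w - 1) + t * w + (w - 1) = t * w by ring] at this
    have e4 : t * ‖w‖ ≤ a + 2 ^ k * b := e3.trans (by linarith)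
    have e5 : (‖w - 1‖ ^ (k + 1)) ^ 2 ≤ 9 ^ k * b ^ 2 := by
      calc _ ≤ (3 ^ k * b) ^ 2 := by gcongr
        _ = _ := by rw [mul_pow, ← pow_mul, mul_comm k 2, pow_mul]; norm_num
    have e6 : (t * ‖w‖) ^ 2 ≤ 2 * a ^ 2 + 2 * (4 ^ k * b ^ 2) := by
      have h1 : (t * ‖w‖) ^ 2 ≤ (a + 2 ^ k * b) ^ 2 := by gcongr
      have h2 : (2 ^ k * b) ^ 2 = 4 ^ k * b ^ 2 := by
        rw [mul_pow, ← pow_mul, mul_comm k 2, pow_mul]; norm_num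
      nlinarith [sq_nonneg (a - 2 ^ k * b)]
    have e7 : (4 : ℝ) ^ k ≤ 9 ^ k := by gcongr; norm_num
    have e8 : (4 : ℝ) ^ k * b ^ 2 ≤ 9 ^ k * b ^ 2 := by gcongr
    have e9 : 1 * a ^ 2 ≤ 9 ^ (k + 1) * a ^ 2 := by gcongr
    have e10 : 0 ≤ 9 ^ k * b ^ 2 := by positivity
    rw [mul_comm 2 (k + 1), pow_mul]
    rw [pow_succ (9 : ℝ) k] at *
    nlinarith
  · have e1 : 1 / 2 ≤ a := by
      have h1 := norm_sub_norm_le (1 : ℂ) ((1 - t) * w)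
      have h2 : ‖(1 - (t : ℂ)) * w‖ ≤ 1 / 2 := by
        rw [norm_mul, ← Complex.ofReal_one, ← Complex.ofReal_sub, Complex.norm_real,
          Real.norm_of_nonneg (by linarith)]
        nlinarith [norm_nonneg w]
      have h3 : (1 : ℂ) - (1 - t) * w = -(w - 1) + t * w := by ring
      rw [h3, norm_one, ← ha] at h1
      linarith
    have e2 : ‖w - 1‖ ^ (2 * (k + 1)) ≤ 9 ^ (k + 1) := by
      calc _ ≤ (3 : ℝ) ^ (2 * (k + 1)) := by gcongr; linarith
        _ = _ := by rw [pow_mul]; norm_num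
    have e3 : (t * ‖w‖) ^ 2 ≤ 1 ^ 2 := by
      gcongr
      nlinarith [norm_nonneg w]
    have e4 : 1 / 4 ≤ a ^ 2 := by nlinarith
    nlinarith [sq_nonneg b]

theorem not_cauchyComplete_of_ne (hn : 2 ≤ n) (hpq : p ≠ q) :
    ¬ CauchyComplete (l2Dist : Fibre n p q → Fibre n p q → ℝ≥0∞) := by
  obtain ⟨m, hm, hle⟩ := le_nsq_smul_add_smul (wedge_homCoord_ne_zero hpq)
  set f : Polynomial ℂ := (Polynomial.X - Polynomial.C 1) * Polynomial.X ^ (n - 1) with hf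
  set g : Polynomial ℂ := -(Polynomial.X - Polynomial.C 1) with hg
  have hfm : f.Monic := (Polynomial.monic_X_sub_C 1).mul (Polynomial.monic_X_pow _)
  have hfd : f.natDegree = n := by
    rw [hf, (Polynomial.monic_X_sub_C 1).natDegree_mul (Polynomial.monic_X_pow _),
      Polynomial.natDegree_X_sub_C, Polynomial.natDegree_X_pow]
    omega
  have hgd : g.natDegree = 1 := by rw [hg, Polynomial.natDegree_neg, Polynomial.natDegree_X_sub_C]
  have hX : (Polynomial.X : Polynomial ℂ).natDegree ≤ n := by
    rw [Polynomial.natDegree_X]; omega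
  set c := polyVec n g (homCoord p) + polyVec n f (homCoord q) with hc
  set v := polyVec n Polynomial.X (homCoord p) with hv
  have hce : ∀ w, evalPair c w =
      (-(w - 1)) • homCoord p + ((w - 1) * w ^ (n - 1)) • homCoord q := fun w => by
    rw [hc, evalPair_add, evalPair_polyVec hfd.le, evalPair_polyVec (by omega)]
    simp [hf, hg]
  have hve : ∀ w, evalPair v w = w • homCoord p := fun w => by
    rw [hv, evalPair_polyVec hX, Polynomial.eval_X]
  have hcr : evalPair (revCoeffs c) 0 = homCoord q := by
    rw [hc, revCoeffs_add, evalPair_add, evalPair_revCoeffs_polyVec, evalPair_revCoeffs_polyVec,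
      Polynomial.coeff_eq_zero_of_natDegree_lt (by omega), zero_smul, zero_add]
    nth_rw 1 [← hfd]
    rw [hfm.coeff_natDegree, one_smul]
  have hvr : evalPair (revCoeffs v) 0 = 0 := by
    rw [hv, evalPair_revCoeffs_polyVec, Polynomial.coeff_X_of_ne_one (by omega), zero_smul]
  have hcv : ∀ (t : ℝ) w, evalPair (c + t • v) w =
      (-(w - 1) + t * w) • homCoord p + ((w - 1) * w ^ (n - 1)) • homCoord q := fun t w => by
    rw [← Complex.coe_smul, evalPair_add, evalPair_smul, hce, hve, smul_smul, add_smul]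
    abel
  refine not_cauchyComplete_of_bubble (c := c) hn hve (κ := m * (1 / (8 * 9 ^ n))) (by positivity)
    (fun t ht w => ?_) hvr ⟨?_, ?_⟩ ?_ ?_
  · rw [mul_assoc, hcv]
    exact (mul_le_mul_of_nonneg_left (bubble_bound_of_ne hn ht w) hm.le).trans (hle _ _)
  · rw [hce, zero_pow (by omega), mul_zero, zero_smul, add_zero, wedge_smul_left, wedge_self,
      mul_zero]
  · rw [hcr, wedge_self]
  · rw [hcr]; exact homCoord_ne_zero q
  · simp [hce]

theorem not_cauchyComplete (hn : 2 ≤ n) (p q : OnePoint ℂ) :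
    ¬ CauchyComplete (l2Dist : Fibre n p q → Fibre n p q → ℝ≥0∞) := by
  by_cases h : p = q
  · subst h
    exact not_cauchyComplete_of_eq hn p
  · exact not_cauchyComplete_of_ne hn h

end Bubble

end CylinderLumps

end

theorem mainTheorem1 (n : ℕ) (hn : 2 ≤ n) (p q : OnePoint ℂ) :
    ¬ CylinderLumps.CauchyComplete
        (CylinderLumps.l2Dist : CylinderLumps.Fibre n p q → CylinderLumps.Fibre n p q → ENNReal) ∧
      ¬ CylinderLumps.GeodesicallyComplete
        (CylinderLumps.l2Dist :
          CylinderLumps.Fibre n p q → CylinderLumps.Fibre n p q → ENNReal) :=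
  ⟨CylinderLumps.not_cauchyComplete hn p q, fun h => CylinderLumps.not_cauchyComplete hn p q
    (CylinderLumps.cauchyComplete_of_geodesicallyComplete CylinderLumps.isLengthSpace_fibre h)⟩
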